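/- **Lemma 4.1.** Let $\mathbb{D}=\{z\in\mathbb{C}:|z|<1\}$. For a holomorphic $g:\mathbb{D}\to\mathbb{D}$ let $\mathcal{C}_g$ be the collection of critical points of $g$ in $\mathbb{D}$, i.e. of zeros of $g'$, counted with multiplicity, and let $\alpha_g:=\liminf_{z\to1}\frac{1-|g(z)|}{1-|z|}$. For $m>0$ let $S(m,1)$ be the hyperbolic Stolz region, i.e. the set of all $z\in\mathbb{D}$ whose hyperbolic distance to the diameter $(-1,1)$ is less than $m$, where the hyperbolic distance is $d_{\mathbb{D}}(z,w)=2\tanh^{-1}\left|\frac{z-w}{1-\bar z w}\right|$. A sequence $(z_n)\subseteq\mathbb{D}$ converges non-tangentially to $1$ if $z_n\to1$ and, for some $m>0$, $z_n\in S(m,1)$ for all sufficiently large $n$. We write $g(1)=\sigma$ if, for every $m>0$, $g(z)\to\sigma$ as $z\to1$ within $S(m,1)$. A (finite or infinite, nonconstant) Blaschke product $B$ is called a maximal Blaschke product for a holomorphic $f:\mathbb{D}\to\mathbb{D}$ if $\mathcal{C}_B$ is a subcollection of $\mathcal{C}_f$ and $$\frac{|g'(z)|}{1-|g(z)|^2}\le\frac{|B'(z)|}{1-|B(z)|^2}\qquad\text{for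 all }z\in\mathbb{D}$$ for every holomorphic $g:\mathbb{D}\to\mathbb{D}$ such that $\mathcal{C}_B$ is a subcollection of $\mathcal{C}_g$. Let $f:\mathbb{D}\to\mathbb{D}$ be a holomorphic function and $B$ a maximal Blaschke product for $f$. Assume that $\alpha_B\in(0,\infty)$ and $B(1)=1$. If there is a sequence $(z_n)\subseteq\mathbb{D}$ such that $z_n\to1$ non-tangentially and $$f(z_n)=B(z_n)+O(|1-z_n|)\quad\text{as }n\to\infty,$$ then the limit $$A:=\lim_{n\to\infty}\frac{1-|f(z_n)|}{1-|B(z_n)|}$$ exists and lies in $(0,\infty)$, and there is a simply connected domain $V\subseteq\mathbb{D}$ with $1\in\partial V$ such that $$\frac{|1-f(v)|^2}{1-|f(v)|^2}\le A\,\frac{|1-B(v)|^2}{1-|B(v)|^2}\qquad\text{for all }v\in V.$$ Moreover, if $f(z_n)=B(z_n)+o(|1-z_n|)$ as $n\to\infty$, then $A=1$. -/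

import Mathlib

open Filter Topology Asymptotics

namespace BlaschkeJulia

noncomputable section

/-- The open unit disk in `ℂ`. -/
abbrev disk : Set ℂ := Metric.ball (0 : ℂ) 1

/-- `f` restricts to a holomorphic function from the unit disk to itself. -/
def IsHolSelfMap (f : ℂ → ℂ) : Prop :=
  DifferentiableOn ℂ f disk ∧ Set.MapsTo f disk disk

/-- The Blaschke factor with zero `a`, in its usual normalisation. -/
def blaschkeFactor (a z : ℂ) : ℂ :=
  if a = 0 then z
  else ((‖a‖ : ℂ) / a) * ((a - z) / (1 - (starRingEnd ℂ) a * z))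

/-- `B` is, on the unit disk, a (finite or infinite, nonconstant) Blaschke product: a unimodular
constant times the locally uniformly convergent product of the Blaschke factors with zeros `a i`,
listed with multiplicity and satisfying the Blaschke condition `∑ (1 - |a i|) < ∞`. The summability
forces the index type to be countable. -/
def IsBlaschkeProduct (B : ℂ → ℂ) : Prop :=
  ∃ (ι : Type) (a : ι → ℂ) (c : ℂ) (P : ℂ → ℂ),
    Nonempty ι ∧ ‖c‖ = 1 ∧ (∀ i, a i ∈ disk) ∧ Summable (fun i => 1 - ‖a i‖) ∧
    HasProdLocallyUniformlyOn (fun i z => blaschkeFactor (a i) z) P disk ∧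
    ∀ z ∈ disk, B z = c * P z

/-- The collection of critical points of `g` in the disk, counted with multiplicity, is a
subcollection of that of `f`: at each point `z` of the disk, the order of vanishing of `g'` is at
most that of `f'` (the latter being `⊤` if `f` is constant). -/
def CriticalSubcollection (g f : ℂ → ℂ) : Prop :=
  ∀ z ∈ disk, analyticOrderAt (deriv g) z ≤ analyticOrderAt (deriv f) z

/-- `B` is a maximal Blaschke product for `f`. -/
def IsMaximalBlaschkeProduct (B f : ℂ → ℂ) : Prop :=
  IsBlaschkeProduct B ∧ CriticalSubcollection B f ∧
    ∀ g : ℂ → ℂ, IsHolSelfMap g → CriticalSubcollection B g →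
      ∀ z ∈ disk, ‖deriv g z‖ / (1 - ‖g z‖ ^ 2) ≤ ‖deriv B z‖ / (1 - ‖B z‖ ^ 2)

/-- The hyperbolic distance between points of the unit disk. -/
def hypDist (z w : ℂ) : ℝ :=
  2 * Real.artanh ‖(z - w) / (1 - (starRingEnd ℂ) z * w)‖

/-- The hyperbolic geodesic line with end points `ξ` and `-ξ` (for `|ξ| = 1`), that is, the open
Euclidean diameter between these points. -/
def diameterGeodesic (ξ : ℂ) : Set ℂ := {w | ∃ t : ℝ, -1 < t ∧ t < 1 ∧ w = t * ξ}

/-- The hyperbolic Stolz region of width `2m` anchored at `ξ`: the points of the disk whose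
hyperbolic distance to the geodesic from `ξ` to `-ξ` (an infimum) is less than `m`. -/
def stolzRegion (m : ℝ) (ξ : ℂ) : Set ℂ :=
  {z | z ∈ disk ∧ ∃ w ∈ diameterGeodesic ξ, hypDist z w < m}

/-- The sequence `z` converges non-tangentially to `ξ`. -/
def TendstoNonTangentially (z : ℕ → ℂ) (ξ : ℂ) : Prop :=
  Tendsto z atTop (𝓝 ξ) ∧ ∃ m : ℝ, 0 < m ∧ ∀ᶠ n in atTop, z n ∈ stolzRegion m ξ

/-- `g` has the non-tangential (angular) limit `σ` at `ξ`. -/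
def HasAngularLimit (g : ℂ → ℂ) (ξ σ : ℂ) : Prop :=
  ∀ m : ℝ, 0 < m → Tendsto g (𝓝[stolzRegion m ξ] ξ) (𝓝 σ)

/-- The boundary dilation coefficient of a self-map `g` of the disk at the boundary point `ξ`, the
lower limit of `(1 - |g z|) / (1 - |z|)` as `z` tends to `ξ` in the disk, as an element of
`[0, ∞]` (the quotients are positive). -/
def boundaryDilation (g : ℂ → ℂ) (ξ : ℂ) : ENNReal :=
  liminf (fun z => ENNReal.ofReal ((1 - ‖g z‖) / (1 - ‖z‖))) (𝓝[disk] ξ)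

end

end BlaschkeJulia

/-! The Cayley transform sends the disk to the right half-plane and the boundary point 1 to
infinity, turning `B` and `f` into self-maps `F` and `K`. Applied to the competitor `f` itself,
maximality says that `K` pulls the hyperbolic metric back to something no larger than `F` does:
`|K'| / Re K ≤ |F'| / Re F`.

Finite dilation and the radial limit 1 give `Re F(x) ≥ c₀ x` for large real `x` (Julia's lemma,
`IsHolSelfMap.exists_julia`). Hence `F(Z)/Z` has a positive angular limit `c` at infinity, and
Cauchy estimates give `F' → c` in sectors. So `F` is injective on a truncated sector and its image
contains another truncated sector (`exists_openPartialHomeomorph_sector`). There `H = K ∘ F⁻¹` is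
defined and satisfies `|H'(w)| ≤ Re H(w) / Re w`.

Such an `H` need not extend to the half-plane, but the differential inequality suffices for a
Julia–Carathéodory theory. Along horizontal rays `Re H / Re w` decreases, so it has a limit `b`; the
imaginary part is negligible on the axis; a Vitali argument extends `H(w)/w → b` to narrower sectors
(`IsContractionOnSector.exists_angular_derivative`). Monotonicity then yields `b Re w ≤ Re H(w)`
(`IsContractionOnSector.mul_re_le`). Pulled back, this is the asserted inequality with `A = 1/b`, on
the preimage of a sector, which is simply connected because it is homeomorphic to a convex set
(`exists_simplyConnected_julia`).

Along `z n` one finds `(1 - B)/(1 - z) → 1/c`, while `(1 - z)/(1 - f) → bc`. If `b` were 0, `f`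
would be too far from `B` for the `O` hypothesis; under the `o` hypothesis `1/c = 1/(bc)`, so `b =
1`. -/

namespace BlaschkeJulia

/-! ### From convergence on a radius to uniform convergence -/

/-- A Vitali-type theorem: a uniformly bounded family of holomorphic functions on a disk which tends
to zero pointwise on a radius tends to zero uniformly on smaller disks. -/
theorem eventually_norm_le_of_tendsto_radius {ι : Type*} {l : Filter ι} {g : ι → ℂ → ℂ}
    {ρ M r : ℝ}
    (hd : ∀ᶠ i in l, DifferentiableOn ℂ (g i) (Metric.ball 0 ρ))
    (hM : ∀ᶠ i in l, ∀ ζ ∈ Metric.ball (0 : ℂ) ρ, ‖g i ζ‖ ≤ M)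
    (ht : ∀ t : ℝ, 0 ≤ t → t < ρ → Tendsto (fun i => g i t) l (𝓝 0))
    (hr0 : 0 ≤ r) (hr : r < ρ) {ε : ℝ} (hε : 0 < ε) :
    ∀ᶠ i in l, ∀ ζ : ℂ, ‖ζ‖ ≤ r → ‖g i ζ‖ ≤ ε := by
  rcases l.eq_or_neBot with rfl | hl
  · simp
  obtain ⟨s, hrs, hsρ⟩ := exists_between hr
  have hs : 0 < s := hr0.trans_lt hrs
  set a : ι → ℕ → ℂ := fun i k => (k.factorial : ℂ)⁻¹ * iteratedDeriv k (g i) 0 with ha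
  have hM0 : 0 ≤ M := by
    obtain ⟨i, hi⟩ := hM.exists
    exact (norm_nonneg _).trans (hi 0 (Metric.mem_ball_self (hs.trans hsρ)))
  have hcoef : ∀ᶠ i in l, ∀ k, ‖a i k‖ ≤ M / s ^ k := by
    filter_upwards [hd, hM] with i hdi hMi k
    have h := Complex.norm_iteratedDeriv_le_of_forall_mem_sphere_norm_le (f := g i) (c := 0)
      (C := M) k hs
      (hdi.diffContOnCl_ball (Metric.closedBall_subset_ball hsρ))
      (fun z hz => hMi z (Metric.sphere_subset_closedBall.trans
        (Metric.closedBall_subset_ball hsρ) hz))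
    have hk : (0 : ℝ) < k.factorial := by positivity
    simp only [ha, norm_mul, norm_inv, Complex.norm_natCast]
    calc (k.factorial : ℝ)⁻¹ * ‖iteratedDeriv k (g i) 0‖
        ≤ (k.factorial : ℝ)⁻¹ * (k.factorial * M / s ^ k) := by gcongr
      _ = M / s ^ k := by field_simp
  have hsum : ∀ᶠ i in l, ∀ ζ ∈ Metric.ball (0 : ℂ) ρ, HasSum (fun k => a i k * ζ ^ k) (g i ζ) := by
    filter_upwards [hd] with i hdi ζ hζ
    have := Complex.hasSum_taylorSeries_on_ball hdi hζ
    simpa [ha, smul_eq_mul, mul_assoc, mul_comm, mul_left_comm] using this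
  -- Each Taylor coefficient tends to 0, by induction: subtract the lower terms at a small point `t`
  -- of the radius and divide by `t ^ k`. The Cauchy bounds at the intermediate radius `s` control
  -- the higher terms.
  have htend : ∀ k, Tendsto (fun i => a i k) l (𝓝 0) := by
    intro k
    induction k using Nat.strong_induction_on with
    | _ k ih =>
      rw [Metric.tendsto_nhds]
      intro δ hδ
      -- With `t ≤ s / 2` the tail beyond degree `k` is at most `2 M (t / s) ^ (k + 1)`; the last
      -- condition makes this at most `t ^ k * (δ / 4)`.
      obtain ⟨t, ht0, hts, htδ⟩ : ∃ t : ℝ, 0 < t ∧ t ≤ s / 2 ∧ 2 * M * t / s ^ (k + 1) ≤ δ / 4 := by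
        refine ⟨min (s / 2) (δ / 4 * s ^ (k + 1) / (2 * M + 1)), by positivity,
          min_le_left _ _, ?_⟩
        rw [div_le_iff₀ (by positivity)]
        have h1 : min (s / 2) (δ / 4 * s ^ (k + 1) / (2 * M + 1))
            ≤ δ / 4 * s ^ (k + 1) / (2 * M + 1) := min_le_right _ _
        calc 2 * M * min (s / 2) (δ / 4 * s ^ (k + 1) / (2 * M + 1))
            ≤ (2 * M + 1) * (δ / 4 * s ^ (k + 1) / (2 * M + 1)) := by
              gcongr
              linarith
          _ = δ / 4 * s ^ (k + 1) := by field_simp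
      have hlow : Tendsto (fun i => g i t - ∑ j ∈ Finset.range k, a i j * (t : ℂ) ^ j) l (𝓝 0) := by
        have h2 : Tendsto (fun i => ∑ j ∈ Finset.range k, a i j * (t : ℂ) ^ j) l (𝓝 0) := by
          rw [show (0 : ℂ) = ∑ j ∈ Finset.range k, 0 * (t : ℂ) ^ j by simp]
          exact tendsto_finsetSum _ fun j hj => (ih j (Finset.mem_range.1 hj)).mul_const _
        simpa using (ht t ht0.le (by linarith)).sub h2
      have hsmall : ∀ᶠ i in l,
          ‖g i t - ∑ j ∈ Finset.range k, a i j * (t : ℂ) ^ j‖ < t ^ k * (δ / 4) := by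
        have := (Metric.tendsto_nhds.1 hlow) (t ^ k * (δ / 4)) (by positivity)
        simpa [dist_zero_right] using this
      filter_upwards [hsmall, hcoef, hsum] with i hi hci hsi
      rw [dist_zero_right]
      have htρ : (t : ℂ) ∈ Metric.ball (0 : ℂ) ρ := by
        simp [abs_of_pos ht0]; linarith
      have hS := (hasSum_nat_add_iff' (k + 1)).2 (hsi t htρ)
      have hgeo : HasSum (fun n : ℕ => M * (t / s) ^ (k + 1) * (t / s) ^ n)
          (M * (t / s) ^ (k + 1) * (1 - t / s)⁻¹) :=
        (hasSum_geometric_of_lt_one (by positivity)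
          (by rw [div_lt_one hs]; linarith)).mul_left _
      have htail : ‖g i t - ∑ j ∈ Finset.range (k + 1), a i j * (t : ℂ) ^ j‖
          ≤ M * (t / s) ^ (k + 1) * (1 - t / s)⁻¹ := by
        rw [← hS.tsum_eq]
        refine tsum_of_norm_bounded hgeo fun n => ?_
        rw [norm_mul, norm_pow, Complex.norm_real, Real.norm_of_nonneg ht0.le]
        calc ‖a i (n + (k + 1))‖ * t ^ (n + (k + 1))
            ≤ M / s ^ (n + (k + 1)) * t ^ (n + (k + 1)) := by gcongr; exact hci _
          _ = M * (t / s) ^ (k + 1) * (t / s) ^ n := by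
            rw [div_pow, div_pow, pow_add, pow_add]; field_simp; ring
      have hinv : (1 - t / s)⁻¹ ≤ 2 := by
        rw [inv_le_comm₀ _ two_pos]
        · have : t / s ≤ 1 / 2 := by rw [div_le_iff₀ hs]; linarith
          linarith
        · rw [sub_pos, div_lt_one hs]; linarith
      have htail2 : M * (t / s) ^ (k + 1) * (1 - t / s)⁻¹ ≤ t ^ k * (δ / 4) := by
        calc M * (t / s) ^ (k + 1) * (1 - t / s)⁻¹ ≤ M * (t / s) ^ (k + 1) * 2 := by gcongr
          _ = t ^ k * (2 * M * t / s ^ (k + 1)) := by rw [div_pow, pow_succ]; ring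
          _ ≤ t ^ k * (δ / 4) := by gcongr
      have hak : ‖a i k * (t : ℂ) ^ k‖ ≤ t ^ k * (δ / 4) + t ^ k * (δ / 4) := by
        rw [Finset.sum_range_succ] at htail
        calc ‖a i k * (t : ℂ) ^ k‖
            = ‖(g i t - ∑ j ∈ Finset.range k, a i j * (t : ℂ) ^ j) -
              (g i t - (∑ j ∈ Finset.range k, a i j * (t : ℂ) ^ j + a i k * (t : ℂ) ^ k))‖ := by
              congr 1; ring
          _ ≤ _ := (norm_sub_le _ _).trans (add_le_add hi.le (htail.trans htail2))
      rw [norm_mul, norm_pow, Complex.norm_real, Real.norm_of_nonneg ht0.le] at hak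
      have htk : 0 < t ^ k := by positivity
      have : t ^ k * ‖a i k‖ ≤ t ^ k * (δ / 2) := by linarith
      have := le_of_mul_le_mul_left this htk
      linarith
  have hdom : Tendsto (fun i => ∑' k, ‖a i k‖ * r ^ k) l (𝓝 (∑' k : ℕ, (0 : ℝ))) := by
    refine tendsto_tsum_of_dominated_convergence (bound := fun k => M * (r / s) ^ k) ?_ ?_ ?_
    · exact (summable_geometric_of_lt_one (by positivity) (by rw [div_lt_one hs]; exact hrs)).mul_left _
    · intro k
      simpa using (htend k).norm.mul_const (r ^ k)
    · filter_upwards [hcoef] with i hi k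
      rw [Real.norm_of_nonneg (by positivity), div_pow, ← mul_div_assoc, mul_div_right_comm]
      gcongr
      exact hi k
  rw [tsum_zero] at hdom
  filter_upwards [hdom.eventually (gt_mem_nhds hε), hsum, hcoef] with i hi hsi hci ζ hζ
  have hsm : Summable (fun k => ‖a i k‖ * r ^ k) := by
    refine Summable.of_nonneg_of_le (fun k => by positivity) (fun k => ?_)
      ((summable_geometric_of_lt_one (r := r / s) (by positivity)
        (by rw [div_lt_one hs]; exact hrs)).mul_left M)
    rw [div_pow, ← mul_div_assoc, mul_div_right_comm]
    gcongr
    exact hci k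
  rw [← (hsi ζ (by simp; linarith)).tsum_eq]
  refine (tsum_of_norm_bounded hsm.hasSum fun k => ?_).trans hi.le
  rw [norm_mul, norm_pow]
  gcongr

/-! ### Truncated sectors -/

/-- The truncated sector of slope `κ` around the positive real axis, right of the abscissa `R`. -/
def sector (κ R : ℝ) : Set ℂ := {w | R < w.re ∧ |w.im| < κ * w.re}

theorem isOpen_sector (κ R : ℝ) : IsOpen (sector κ R) :=
  (isOpen_lt continuous_const Complex.continuous_re).inter
    (isOpen_lt Complex.continuous_im.abs (continuous_const.mul Complex.continuous_re))

theorem convex_sector (κ R : ℝ) : Convex ℝ (sector κ R) := by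
  rintro x ⟨hx1, hx2⟩ y ⟨hy1, hy2⟩ a b ha hb hab
  have hxy : (a • x + b • y).re = a * x.re + b * y.re := by simp
  have hxy' : (a • x + b • y).im = a * x.im + b * y.im := by simp
  refine ⟨?_, ?_⟩
  · rw [hxy]
    have h := (convex_Ioi R) hx1 hy1 ha hb hab
    simpa using h
  · rw [hxy, hxy']
    have h := (convex_Ioi (0 : ℝ)) (x := κ * x.re - |x.im|) (y := κ * y.re - |y.im|)
      (by simpa using hx2) (by simpa using hy2) ha hb hab
    have h1 : |a * x.im + b * y.im| ≤ a * |x.im| + b * |y.im| := by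
      refine (abs_add_le _ _).trans ?_
      rw [abs_mul, abs_mul, abs_of_nonneg ha, abs_of_nonneg hb]
    simp only [smul_eq_mul, Set.mem_Ioi] at h
    nlinarith

theorem sector_mono {κ κ' R R' : ℝ} (hR' : 0 ≤ R') (hκ : κ' ≤ κ) (hR : R ≤ R') :
    sector κ' R' ⊆ sector κ R := fun _ ⟨h1, h2⟩ =>
  ⟨hR.trans_lt h1, h2.trans_le (mul_le_mul_of_nonneg_right hκ (hR'.trans h1.le))⟩

theorem ofReal_mem_sector {κ R x : ℝ} (hκ : 0 < κ) (hR : 0 ≤ R) (hx : R < x) :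
    (x : ℂ) ∈ sector κ R := by
  simp only [sector, Set.mem_ofPred_eq, Complex.ofReal_re, Complex.ofReal_im, abs_zero]
  exact ⟨hx, mul_pos hκ (hR.trans_lt hx)⟩

theorem add_ofReal_mem_sector {κ R t : ℝ} {w : ℂ} (hκ : 0 ≤ κ) (hw : w ∈ sector κ R) (ht : 0 ≤ t) :
    w + t ∈ sector κ R := by
  obtain ⟨h1, h2⟩ := hw
  simp only [sector, Set.mem_ofPred_eq, Complex.add_re, Complex.ofReal_re, Complex.add_im,
    Complex.ofReal_im, add_zero]
  exact ⟨by linarith, by nlinarith⟩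

theorem norm_le_of_mem_sector {κ R : ℝ} (hR : 0 ≤ R) {w : ℂ} (hw : w ∈ sector κ R) :
    ‖w‖ ≤ (1 + κ) * w.re := by
  have h := Complex.norm_le_abs_re_add_abs_im w
  rw [abs_of_pos (hR.trans_lt hw.1)] at h
  linarith [hw.2]

/-! ### Hyperbolic contractions on a sector and their angular derivative at infinity -/

/-- A holomorphic map from a truncated sector to the right half-plane which does not increase
the hyperbolic metric of the right half-plane. -/
structure IsContractionOnSector (H : ℂ → ℂ) (κ R : ℝ) : Prop where
  slope_pos : 0 < κ
  nonneg : 0 ≤ R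
  diff : DifferentiableOn ℂ H (sector κ R)
  re_pos : ∀ w ∈ sector κ R, 0 < (H w).re
  deriv_le : ∀ w ∈ sector κ R, ‖deriv H w‖ ≤ (H w).re / w.re

namespace IsContractionOnSector

variable {H : ℂ → ℂ} {κ R : ℝ}

theorem hasDerivAt_ray (hH : IsContractionOnSector H κ R) {w : ℂ} (hw : w ∈ sector κ R) {t : ℝ}
    (ht : 0 ≤ t) :
    HasDerivAt (fun s : ℝ => H (w + s)) (deriv H (w + t)) t := by
  have h1 : HasDerivAt H (deriv H (w + t)) (w + t) :=
    (hH.diff.differentiableAt ((isOpen_sector κ R).mem_nhds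
      (add_ofReal_mem_sector hH.slope_pos.le hw ht))).hasDerivAt
  have h2 : HasDerivAt (fun s : ℝ => w + (s : ℂ)) 1 t := by
    simpa using (Complex.ofRealCLM.hasDerivAt (x := t)).const_add w
  have h3 := h1.comp t h2
  rw [mul_one] at h3
  exact h3

theorem hasDerivAt_re_ray (hH : IsContractionOnSector H κ R) {w : ℂ} (hw : w ∈ sector κ R) {t : ℝ}
    (ht : 0 ≤ t) :
    HasDerivAt (fun s : ℝ => (H (w + s)).re) (deriv H (w + t)).re t :=
  Complex.reCLM.hasFDerivAt.comp_hasDerivAt t (hH.hasDerivAt_ray hw ht)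

theorem hasDerivAt_im_ray (hH : IsContractionOnSector H κ R) {w : ℂ} (hw : w ∈ sector κ R) {t : ℝ}
    (ht : 0 ≤ t) :
    HasDerivAt (fun s : ℝ => (H (w + s)).im) (deriv H (w + t)).im t :=
  Complex.imCLM.hasFDerivAt.comp_hasDerivAt t (hH.hasDerivAt_ray hw ht)

/-- The quotient rule reduces this to `Re H' ≤ |H'| ≤ Re H / Re w`. This monotonicity replaces the
global Schwarz–Pick argument, as `H` lives only on a sector. -/
theorem antitoneOn_re_div_re (hH : IsContractionOnSector H κ R) {w : ℂ} (hw : w ∈ sector κ R) :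
    AntitoneOn (fun t : ℝ => (H (w + t)).re / (w.re + t)) (Set.Ici 0) := by
  have hw0 : 0 < w.re := hH.nonneg.trans_lt hw.1
  have hder : ∀ t : ℝ, 0 ≤ t → HasDerivAt (fun t : ℝ => (H (w + t)).re / (w.re + t))
      (((deriv H (w + t)).re * (w.re + t) - (H (w + t)).re * 1) / (w.re + t) ^ 2) t := fun t ht =>
    (hH.hasDerivAt_re_ray hw ht).div ((hasDerivAt_id t).const_add w.re) (by
      have : 0 < w.re + t := by positivity
      exact this.ne')
  refine antitoneOn_of_deriv_nonpos (convex_Ici 0)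
    (fun t ht => (hder t ht).continuousAt.continuousWithinAt)
    (fun t ht => (hder t (interior_subset ht)).differentiableAt.differentiableWithinAt) fun t ht => ?_
  have ht : 0 ≤ t := interior_subset ht
  rw [(hder t ht).deriv]
  have h1 := hH.deriv_le _ (add_ofReal_mem_sector hH.slope_pos.le hw ht)
  have h2 : (w + (t : ℂ)).re = w.re + t := by simp
  rw [h2, le_div_iff₀ (by positivity)] at h1
  have h3 : (deriv H (w + t)).re * (w.re + t) ≤ ‖deriv H (w + t)‖ * (w.re + t) := by
    gcongr
    exact Complex.re_le_norm _
  exact div_nonpos_of_nonpos_of_nonneg (by linarith) (by positivity)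

theorem exists_tendsto_re_div (hH : IsContractionOnSector H κ R) :
    ∃ c : ℝ, 0 ≤ c ∧ Tendsto (fun x : ℝ => (H x).re / x) atTop (𝓝 c) ∧
      ∀ x : ℝ, R < x → c ≤ (H x).re / x := by
  have hR := hH.nonneg
  have hmem : ((R + 1 : ℝ) : ℂ) ∈ sector κ R := ofReal_mem_sector hH.slope_pos hR (by linarith)
  have hanti := hH.antitoneOn_re_div_re hmem
  -- Truncating at `max t 0` extends the monotone function constantly to the whole line, so that its
  -- limit is its infimum.
  set φ : ℝ → ℝ := fun t => (H ((R + 1 : ℝ) + (max t 0 : ℝ))).re / (R + 1 + max t 0) with hφ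
  have hφa : Antitone φ := fun s t hst => by
    have := hanti (a := max s 0) (b := max t 0) (Set.mem_Ici.2 (le_max_right _ _))
      (Set.mem_Ici.2 (le_max_right _ _)) (max_le_max_right 0 hst)
    simpa [hφ] using this
  have hbdd : BddBelow (Set.range φ) := by
    refine ⟨0, ?_⟩
    rintro _ ⟨t, rfl⟩
    have h1 := hH.re_pos _ (add_ofReal_mem_sector hH.slope_pos.le hmem (le_max_right t 0))
    have : 0 ≤ max t 0 := le_max_right _ _
    exact div_nonneg h1.le (by positivity)
  have hlim := tendsto_atTop_ciInf hφa hbdd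
  have hev : ∀ x : ℝ, R + 1 ≤ x → φ (x - (R + 1)) = (H x).re / x := by
    intro x hx
    simp only [hφ]
    rw [max_eq_left (by linarith)]
    congr 3 <;> push_cast <;> ring
  have hT : Tendsto (fun x : ℝ => (H x).re / x) atTop (𝓝 (⨅ t, φ t)) := by
    refine (hlim.comp (tendsto_atTop_add_const_right _ (-(R + 1)) tendsto_id)).congr' ?_
    filter_upwards [eventually_ge_atTop (R + 1)] with x hx
    simpa [sub_eq_add_neg] using hev x hx
  refine ⟨_, ?_, hT, fun x hx => ?_⟩
  · refine ge_of_tendsto hT ?_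
    filter_upwards [eventually_gt_atTop R] with x hx
    exact div_nonneg (hH.re_pos _ (ofReal_mem_sector hH.slope_pos hR hx)).le (hR.trans hx.le)
  · refine le_of_tendsto hT ?_
    filter_upwards [eventually_ge_atTop x] with y hy
    have := hH.antitoneOn_re_div_re (ofReal_mem_sector hH.slope_pos hR hx) (a := 0) (b := y - x)
      (Set.mem_Ici.2 le_rfl) (sub_nonneg.2 hy) (sub_nonneg.2 hy)
    simpa using this

/-- Let `ψ = Re H / Re w`. Since `|H'| ≤ ψ`, one has `(Im H')² ≤ ψ² - (Re H')² ≤ 2M (ψ - Re H')`. As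
`ψ` is close to `c` and `Re H` grows at least like `c x`, the right side is small on average, so `Im
H` grows sublinearly. The sign `s` treats both directions at once. -/
theorem eventually_im_div_le (hH : IsContractionOnSector H κ R) {c : ℝ} (hc0 : 0 ≤ c)
    (hc : Tendsto (fun x : ℝ => (H x).re / x) atTop (𝓝 c))
    (hcle : ∀ x : ℝ, R < x → c ≤ (H x).re / x) {s : ℝ} (hs : s ^ 2 = 1) {ε : ℝ} (hε : 0 < ε) :
    ∀ᶠ x : ℝ in atTop, s * (H x).im / x ≤ ε := by
  have hR := hH.nonneg
  set M := c + 1 with hM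
  have hMp : 0 < M := by positivity
  set δ := min 1 (ε ^ 2 / (4 * M)) with hδ
  have hδp : 0 < δ := by positivity
  have hδ1 : δ ≤ 1 := min_le_left _ _
  have hδ2 : M / ε * δ ≤ ε / 4 := by
    calc M / ε * δ ≤ M / ε * (ε ^ 2 / (4 * M)) := by gcongr; exact min_le_right _ _
      _ = ε / 4 := by field_simp
  obtain ⟨X, hX⟩ := eventually_atTop.1
    ((hc.eventually (gt_mem_nhds (show c < c + δ by linarith))).and (eventually_gt_atTop R))
  have hXR : R < X := (hX X le_rfl).2
  have hX0 : 0 < X := hR.trans_lt hXR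
  have hmem : (X : ℂ) ∈ sector κ R := ofReal_mem_sector hH.slope_pos hR hXR
  -- By AM–GM, `s Im H' ≤ ε/2 + (Im H')²/(2ε) ≤ ε/2 + (M/ε)(ψ - Re H')`. Integrating this with `ψ <
  -- c + δ` is the statement that `Φ` decreases.
  set Φ : ℝ → ℝ := fun t => s * (H (X + t)).im + M / ε * (H (X + t)).re -
    (ε / 2 + M / ε * (c + δ)) * t with hΦ
  have hder : ∀ t : ℝ, 0 ≤ t → HasDerivAt Φ (s * (deriv H (X + t)).im +
      M / ε * (deriv H (X + t)).re - (ε / 2 + M / ε * (c + δ)) * 1) t := fun t ht =>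
    (((hH.hasDerivAt_im_ray hmem ht).const_mul s).add
      ((hH.hasDerivAt_re_ray hmem ht).const_mul (M / ε))).sub ((hasDerivAt_id t).const_mul _)
  have hanti : AntitoneOn Φ (Set.Ici 0) := by
    refine antitoneOn_of_deriv_nonpos (convex_Ici 0)
      (fun t ht => (hder t ht).continuousAt.continuousWithinAt)
      (fun t ht => (hder t (interior_subset ht)).differentiableAt.differentiableWithinAt)
      fun t ht => ?_
    have ht : 0 ≤ t := interior_subset ht
    rw [(hder t ht).deriv]
    have h1 := hH.deriv_le _ (add_ofReal_mem_sector hH.slope_pos.le hmem ht)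
    have h2 := (hX (X + t) (by linarith)).1
    have h3 : ((X : ℂ) + t).re = X + t := by simp
    push_cast at h2
    rw [h3] at h1
    set ψ := (H (X + t)).re / (X + t)
    set d := deriv H (X + t)
    have h4 : d.re ^ 2 + d.im ^ 2 ≤ ψ ^ 2 := by
      have : ‖d‖ ^ 2 = d.re ^ 2 + d.im ^ 2 := by rw [← Complex.normSq_eq_norm_sq, Complex.normSq_apply]; ring
      rw [← this]
      gcongr
    have h5 : d.re ≤ ψ := (Complex.re_le_norm _).trans h1
    have h6 : d.im ^ 2 ≤ 2 * M * (ψ - d.re) := by nlinarith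
    have h7 : s * d.im ≤ ε / 2 + d.im ^ 2 / (2 * ε) := by
      have : 0 ≤ (s * d.im - ε) ^ 2 / (2 * ε) := by positivity
      have h8 : (s * d.im - ε) ^ 2 / (2 * ε) = d.im ^ 2 / (2 * ε) + ε / 2 - s * d.im := by
        field_simp
        rw [sub_sq, mul_pow, hs]
        ring
      linarith
    have h9 : d.im ^ 2 / (2 * ε) ≤ M / ε * (ψ - d.re) := by
      rw [div_le_iff₀ (by positivity)]
      calc d.im ^ 2 ≤ 2 * M * (ψ - d.re) := h6
        _ = M / ε * (ψ - d.re) * (2 * ε) := by field_simp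
    have h10 : M / ε * ψ ≤ M / ε * (c + δ) := by gcongr
    linarith
  have hev : ∀ᶠ x : ℝ in atTop, Φ 0 / x ≤ ε / 4 :=
    (tendsto_const_nhds.div_atTop tendsto_id).eventually (ge_mem_nhds (by positivity))
  filter_upwards [hev, eventually_ge_atTop X] with x hx hxX
  have hx0 : 0 < x := hX0.trans_le hxX
  have h1 := hanti (Set.mem_Ici.2 le_rfl) (Set.mem_Ici.2 (sub_nonneg.2 hxX)) (sub_nonneg.2 hxX)
  have h2 : ((X : ℂ) + (x - X : ℝ)) = x := by push_cast; ring
  have h3 : Φ (x - X) = s * (H x).im + M / ε * (H x).re - (ε / 2 + M / ε * (c + δ)) * (x - X) := by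
    simp only [hΦ, h2]
  rw [h3] at h1
  have h4 := hcle x (hXR.trans_le hxX)
  rw [le_div_iff₀ hx0] at h4
  rw [div_le_iff₀ hx0] at hx ⊢
  have h5 : M / ε * (c * x) ≤ M / ε * (H x).re := by gcongr
  have h6 : M / ε * δ * x ≤ ε / 4 * x := by gcongr
  have h7 : 0 ≤ (ε / 2 + M / ε * (c + δ)) * X := by positivity
  nlinarith

theorem tendsto_div_ofReal (hH : IsContractionOnSector H κ R) :
    ∃ c : ℝ, 0 ≤ c ∧ Tendsto (fun x : ℝ => H x / x) atTop (𝓝 (c : ℂ)) := by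
  obtain ⟨c, hc0, hc, hcle⟩ := hH.exists_tendsto_re_div
  have him : Tendsto (fun x : ℝ => (H x).im / x) atTop (𝓝 0) := by
    rw [Metric.tendsto_nhds]
    intro ε hε
    filter_upwards [hH.eventually_im_div_le hc0 hc hcle (s := 1) (by norm_num) (half_pos hε),
      hH.eventually_im_div_le hc0 hc hcle (s := -1) (by norm_num) (half_pos hε)] with x h1 h2
    rw [Real.dist_0_eq_abs, abs_lt]
    rw [one_mul] at h1
    rw [neg_one_mul, neg_div] at h2
    constructor <;> linarith
  refine ⟨c, hc0, ?_⟩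
  have h := ((Complex.continuous_ofReal.tendsto c).comp hc).add
    (((Complex.continuous_ofReal.tendsto 0).comp him).mul_const Complex.I)
  simp only [Complex.ofReal_zero, zero_mul, add_zero] at h
  refine h.congr fun x => ?_
  simp only [Function.comp]
  apply Complex.ext <;> simp

/-- A Harnack-type bound: `|(log H)'| = |H'| / |H| ≤ 1 / Re w`, which is at most `1 / ((1 - ρ) x)`
on the ball, and the ball has radius `ρ x`. -/
theorem norm_le_of_ball_subset (hH : IsContractionOnSector H κ R) {x ρ : ℝ} (hx : 0 < x)
    (hρ : 0 < ρ) (hρ1 : ρ < 1) (hsub : Metric.ball (x : ℂ) (ρ * x) ⊆ sector κ R) {w : ℂ}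
    (hw : w ∈ Metric.ball (x : ℂ) (ρ * x)) :
    ‖H w‖ ≤ ‖H x‖ * Real.exp (ρ / (1 - ρ)) := by
  have hxm : (x : ℂ) ∈ Metric.ball (x : ℂ) (ρ * x) := Metric.mem_ball_self (by positivity)
  have hρ2 : 0 < 1 - ρ := by linarith
  have hderiv : ∀ z ∈ Metric.ball (x : ℂ) (ρ * x),
      HasDerivWithinAt (fun z => Complex.log (H z)) (deriv H z / H z)
        (Metric.ball (x : ℂ) (ρ * x)) z := fun z hz =>
    ((hH.diff.differentiableAt ((isOpen_sector κ R).mem_nhds (hsub hz))).hasDerivAt.clog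
      (Or.inl (hH.re_pos z (hsub hz)))).hasDerivWithinAt
  have hbound : ∀ z ∈ Metric.ball (x : ℂ) (ρ * x), ‖deriv H z / H z‖ ≤ 1 / ((1 - ρ) * x) := by
    intro z hz
    have hzre : (1 - ρ) * x ≤ z.re := by
      have h1 : |(z - x).re| ≤ ‖z - x‖ := Complex.abs_re_le_norm _
      rw [mem_ball_iff_norm] at hz
      simp only [Complex.sub_re, Complex.ofReal_re] at h1
      have := abs_le.1 (h1.trans hz.le)
      linarith
    have hre := hH.re_pos z (hsub hz)
    have hp : 0 < (1 - ρ) * x := by positivity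
    rw [norm_div, div_le_div_iff₀ (norm_pos_iff.2 fun h => by simp [h] at hre) hp, one_mul]
    have h2 := hH.deriv_le z (hsub hz)
    rw [le_div_iff₀ (hp.trans_le hzre)] at h2
    calc ‖deriv H z‖ * ((1 - ρ) * x) ≤ ‖deriv H z‖ * z.re := by gcongr
      _ ≤ _ := h2.trans (Complex.re_le_norm _)
  have hmv := (convex_ball (x : ℂ) (ρ * x)).norm_image_sub_le_of_norm_hasDerivWithin_le
    hderiv hbound hxm hw
  have hle : ‖Complex.log (H w) - Complex.log (H x)‖ ≤ ρ / (1 - ρ) := by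
    refine hmv.trans ?_
    rw [mem_ball_iff_norm] at hw
    calc 1 / ((1 - ρ) * x) * ‖w - x‖ ≤ 1 / ((1 - ρ) * x) * (ρ * x) := by gcongr
      _ = ρ / (1 - ρ) := by field_simp
  have hne : ∀ z ∈ Metric.ball (x : ℂ) (ρ * x), H z ≠ 0 := fun z hz h => by
    have := hH.re_pos z (hsub hz)
    simp [h] at this
  have heq : H w = H x * Complex.exp (Complex.log (H w) - Complex.log (H x)) := by
    rw [Complex.exp_sub, Complex.exp_log (hne _ hw), Complex.exp_log (hne _ hxm),
      mul_div_cancel₀ _ (hne _ hxm)]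
  rw [heq, norm_mul, Complex.norm_exp]
  gcongr
  exact (Complex.re_le_norm _).trans hle

end IsContractionOnSector

/-- The relation between `ρ` and `κ` says that `ρ` is the sine of the half-angle of the sector: the
circle of radius `ρ x` about `x` is tangent to its sides. -/
theorem mul_one_add_mem_sector {κ R ρ x : ℝ} (hκ : 0 < κ) (hρ : ρ ^ 2 * (1 + κ ^ 2) = κ ^ 2)
    (hρ1 : ρ < 1) (hx : 0 < x) (hxR : R < (1 - ρ) * x) {ζ : ℂ} (hζ : ‖ζ‖ < ρ) :
    (x : ℂ) * (1 + ζ) ∈ sector κ R := by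
  have hre : ((x : ℂ) * (1 + ζ)).re = x * (1 + ζ.re) := by simp
  have him : ((x : ℂ) * (1 + ζ)).im = x * ζ.im := by simp
  have hsq : ζ.re ^ 2 + ζ.im ^ 2 < ρ ^ 2 := by
    have : ‖ζ‖ ^ 2 = ζ.re ^ 2 + ζ.im ^ 2 := by
      rw [← Complex.normSq_eq_norm_sq, Complex.normSq_apply]; ring
    rw [← this]
    exact pow_lt_pow_left₀ hζ (norm_nonneg _) two_ne_zero
  have h1 : -ρ < ζ.re := by
    have := abs_le.1 (Complex.abs_re_le_norm ζ)
    linarith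
  refine ⟨?_, ?_⟩
  · rw [hre]
    nlinarith
  · rw [hre, him, abs_mul, abs_of_pos hx, mul_left_comm]
    gcongr
    refine abs_lt_of_sq_lt_sq ?_ (by nlinarith)
    have h2 : ζ.im ^ 2 * 1 < κ ^ 2 * (1 + ζ.re) ^ 2 := by
      have h3 : (1 - ρ ^ 2) * (1 + κ ^ 2) = 1 := by linarith
      have h4 : 0 < 1 - ρ ^ 2 := by
        by_contra h
        nlinarith
      have h5 : (1 - ρ ^ 2) * κ ^ 2 = ρ ^ 2 := by linarith
      refine lt_of_mul_lt_mul_left ?_ h4.le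
      have h6 : (1 - ρ ^ 2) * (κ ^ 2 * (1 + ζ.re) ^ 2) = ρ ^ 2 * (1 + ζ.re) ^ 2 := by
        rw [← mul_assoc, h5]
      rw [h6]
      -- Tangency occurs at `ζ.re = -ρ ^ 2`, which is where this square vanishes.
      nlinarith [sq_nonneg (ζ.re + ρ ^ 2)]
    rw [mul_pow]
    linarith

/-- The angular limit of `H w / w` at infinity. -/
theorem IsContractionOnSector.exists_angular_derivative {H : ℂ → ℂ} {κ R : ℝ}
    (hH : IsContractionOnSector H κ R) :
    ∃ c : ℝ, 0 ≤ c ∧ (∀ κ' < κ, ∀ ε > 0, ∃ R' : ℝ, R ≤ R' ∧ ∀ w ∈ sector κ' R',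
      ‖H w - c * w‖ ≤ ε * ‖w‖) := by
  obtain ⟨c, hc0, hc⟩ := hH.tendsto_div_ofReal
  refine ⟨c, hc0, ?_⟩
  suffices h : ∀ κ', 0 < κ' → κ' < κ → ∀ ε > 0, ∃ R' : ℝ, R ≤ R' ∧ ∀ w ∈ sector κ' R',
      ‖H w - c * w‖ ≤ ε * ‖w‖ by
    -- A slope `κ'` that is not positive is replaced by a larger admissible one.
    intro κ' hκ' ε hε
    obtain ⟨R', hR', h'⟩ := h (max κ' (κ / 2)) (lt_max_of_lt_right (half_pos hH.slope_pos))
      (max_lt hκ' (half_lt_self hH.slope_pos)) ε hε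
    exact ⟨R', hR', fun w hw => h' w (sector_mono (hH.nonneg.trans hR') (le_max_left _ _) le_rfl hw)⟩
  intro κ' hκ'0 hκ' ε hε
  have hκ := hH.slope_pos
  have hR := hH.nonneg
  set rad : ℝ → ℝ := fun k => k / √(1 + k ^ 2) with hrad
  have hsq : ∀ k, rad k ^ 2 * (1 + k ^ 2) = k ^ 2 := fun k => by
    have : 0 < 1 + k ^ 2 := by positivity
    simp only [hrad, div_pow, Real.sq_sqrt this.le]
    field_simp
  have hpos : ∀ k, 0 < k → 0 < rad k := fun k hk => by simp only [hrad]; positivity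
  set ρ := rad κ
  set r := rad κ'
  have hρ0 : 0 < ρ := hpos κ hκ
  have hρ1 : ρ < 1 := by
    have := hsq κ
    by_contra h
    push Not at h
    nlinarith [mul_le_mul h h zero_le_one (hρ0.le)]
  have hrρ : r < ρ := by
    refine lt_of_pow_lt_pow_left₀ 2 hρ0.le ?_
    have h1 := hsq κ
    have h2 := hsq κ'
    have h1' : ρ ^ 2 = κ ^ 2 / (1 + κ ^ 2) := by rw [eq_div_iff (by positivity)]; exact h1
    have h2' : r ^ 2 = κ' ^ 2 / (1 + κ' ^ 2) := by rw [eq_div_iff (by positivity)]; exact h2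
    rw [h1', h2', div_lt_div_iff₀ (by positivity) (by positivity)]
    nlinarith
  have hρ2 : 0 < 1 - ρ := by linarith
  have hlarge : ∀ᶠ x : ℝ in atTop, 0 < x ∧ R < (1 - ρ) * x := by
    filter_upwards [eventually_gt_atTop 0, eventually_gt_atTop (R / (1 - ρ))] with x hx hx2
    rw [div_lt_iff₀ hρ2] at hx2
    exact ⟨hx, by linarith⟩
  -- Rescaling moves the problem to a fixed ball of radius `ρ`. The Harnack-type bound makes this
  -- family uniformly bounded, and on the real radius it tends to 0 by the limit along the axis.
  set g : ℝ → ℂ → ℂ := fun x ζ => H (x * (1 + ζ)) / (x * (1 + ζ)) - c with hg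
  have hne : ∀ ζ : ℂ, ‖ζ‖ < ρ → 1 - ρ ≤ ‖1 + ζ‖ := fun ζ hζ => by
    have := norm_sub_norm_le (1 : ℂ) (-ζ)
    simp only [norm_one, norm_neg, sub_neg_eq_add] at this
    linarith
  have hne0 : ∀ ζ : ℂ, ‖ζ‖ < ρ → 1 + ζ ≠ 0 := fun ζ hζ => norm_pos_iff.1 (hρ2.trans_le (hne ζ hζ))
  have hmemS : ∀ x : ℝ, 0 < x ∧ R < (1 - ρ) * x → ∀ ζ : ℂ, ‖ζ‖ < ρ → (x : ℂ) * (1 + ζ) ∈ sector κ R :=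
    fun x hx ζ hζ => mul_one_add_mem_sector hκ (hsq κ) hρ1 hx.1 hx.2 hζ
  have hgd : ∀ᶠ x in atTop, DifferentiableOn ℂ (g x) (Metric.ball 0 ρ) := by
    filter_upwards [hlarge] with x hx
    have haff : DifferentiableOn ℂ (fun ζ : ℂ => (x : ℂ) * (1 + ζ)) (Metric.ball 0 ρ) := by
      fun_prop
    refine ((hH.diff.comp haff fun ζ hζ => hmemS x hx ζ (by simpa using hζ)).div haff
      fun ζ hζ => ?_).sub_const _
    exact mul_ne_zero (by exact_mod_cast hx.1.ne') (hne0 ζ (by simpa using hζ))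
  have hgM : ∀ᶠ x in atTop, ∀ ζ ∈ Metric.ball (0 : ℂ) ρ,
      ‖g x ζ‖ ≤ (c + 1) * Real.exp (ρ / (1 - ρ)) / (1 - ρ) + c := by
    have hb : ∀ᶠ x : ℝ in atTop, ‖H x / x‖ < c + 1 := by
      refine hc.norm.eventually (gt_mem_nhds ?_)
      rw [Complex.norm_real, Real.norm_of_nonneg hc0]
      linarith
    filter_upwards [hlarge, hb] with x hx hbx ζ hζ
    have hζ' : ‖ζ‖ < ρ := by simpa using hζ
    have hx0 := hx.1
    have hballsub : Metric.ball (x : ℂ) (ρ * x) ⊆ sector κ R := by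
      intro w hw
      have h1 := hmemS x hx ((w - x) / x) (by
        rw [norm_div, Complex.norm_real, Real.norm_of_nonneg hx0.le, div_lt_iff₀ hx0]
        exact mem_ball_iff_norm.1 hw)
      have hxc : (x : ℂ) ≠ 0 := by exact_mod_cast hx0.ne'
      convert h1 using 1
      field_simp
      ring
    have h2 := hH.norm_le_of_ball_subset hx0 hρ0 hρ1 hballsub (w := x * (1 + ζ)) (by
      rw [mem_ball_iff_norm, mul_add, mul_one, add_sub_cancel_left, norm_mul, Complex.norm_real,
        Real.norm_of_nonneg hx0.le, mul_comm]
      gcongr)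
    rw [norm_div, Complex.norm_real, Real.norm_of_nonneg hx0.le, div_lt_iff₀ hx0] at hbx
    refine (norm_sub_le _ _).trans ?_
    rw [Complex.norm_real, Real.norm_of_nonneg hc0, norm_div, norm_mul, Complex.norm_real,
      Real.norm_of_nonneg hx0.le]
    refine add_le_add_left ?_ c
    rw [div_le_div_iff₀ (mul_pos hx0 (hρ2.trans_le (hne ζ hζ'))) hρ2]
    calc ‖H (x * (1 + ζ))‖ * (1 - ρ) ≤ ((c + 1) * x * Real.exp (ρ / (1 - ρ))) * ‖1 + ζ‖ := by
          gcongr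
          · exact h2.trans (by gcongr)
          · exact hne ζ hζ'
      _ = _ := by ring
  have hgt : ∀ t : ℝ, 0 ≤ t → t < ρ → Tendsto (fun x => g x t) atTop (𝓝 0) := by
    intro t ht0 _
    have h1 : Tendsto (fun x : ℝ => x * (1 + t)) atTop atTop :=
      tendsto_id.atTop_mul_const (by positivity)
    have h2 := (hc.comp h1).sub_const (c : ℂ)
    rw [sub_self] at h2
    refine h2.congr fun x => ?_
    simp [hg, Function.comp]
  have hfin := eventually_norm_le_of_tendsto_radius hgd hgM hgt (hpos κ' hκ'0).le hrρ hε
  obtain ⟨X, hX⟩ := eventually_atTop.1 (hfin.and hlarge)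
  refine ⟨max R X, le_max_left _ _, fun w hw => ?_⟩
  have hwre : 0 < w.re := hR.trans_lt ((le_max_left _ _).trans_lt hw.1)
  -- The centre is chosen so that a point on the side of the narrower sector is the tangency point
  -- of the circle of radius `r x` about `x`; hence `w` lies in the closed ball.
  set x := (1 + κ' ^ 2) * w.re with hx
  have hXx : X ≤ x := by
    have := ((le_max_right _ _).trans_lt hw.1).le
    have : 0 ≤ κ' ^ 2 * w.re := by positivity
    linarith
  obtain ⟨h1, hx0, hxR⟩ := hX x hXx
  have hxc : (x : ℂ) ≠ 0 := by exact_mod_cast hx0.ne'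
  have hζw : (x : ℂ) * (1 + (w - x) / x) = w := by field_simp; ring
  have hζ : ‖(w - x) / x‖ ≤ r := by
    rw [norm_div, Complex.norm_real, Real.norm_of_nonneg hx0.le, div_le_iff₀ hx0]
    refine le_of_sq_le_sq ?_ (mul_pos (hpos κ' hκ'0) hx0).le
    rw [← Complex.normSq_eq_norm_sq, Complex.normSq_apply, Complex.sub_re, Complex.sub_im,
      Complex.ofReal_re, Complex.ofReal_im, sub_zero]
    have h3 : w.im ^ 2 ≤ (κ' * w.re) ^ 2 := sq_le_sq' (by linarith [abs_lt.1 hw.2]) (abs_lt.1 hw.2).2.le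
    have h4 : (r * x) ^ 2 = κ' ^ 2 * (1 + κ' ^ 2) * w.re ^ 2 := by
      calc (r * x) ^ 2 = (r ^ 2 * (1 + κ' ^ 2)) * (1 + κ' ^ 2) * w.re ^ 2 := by rw [hx]; ring
        _ = _ := by rw [hsq κ']
    rw [h4, hx]
    nlinarith
  have h2 := h1 _ hζ
  simp only [hg, hζw] at h2
  have hw0 : w ≠ 0 := fun h => by simp [h] at hwre
  have h5 : H w - c * w = (H w / w - c) * w := by field_simp
  rw [h5, norm_mul]
  gcongr

/-- Julia's inequality at infinity, for contractions of sectors. -/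
theorem IsContractionOnSector.mul_re_le {H : ℂ → ℂ} {κ R c : ℝ} (hH : IsContractionOnSector H κ R)
    (hc : ∃ κ' > 0, ∀ ε > 0, ∃ R' : ℝ, ∀ w ∈ sector κ' R', ‖H w - c * w‖ ≤ ε * ‖w‖)
    {w : ℂ} (hw : w ∈ sector κ R) : c * w.re ≤ (H w).re := by
  have hw0 : 0 < w.re := hH.nonneg.trans_lt hw.1
  obtain ⟨κ', hκ', hc⟩ := hc
  have key : ∀ ε > 0, c - ε ≤ (H w).re / w.re := by
    intro ε hε
    obtain ⟨R', hR'⟩ := hc (ε / (1 + κ')) (by positivity)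
    -- A horizontal ray eventually enters every truncated sector, however thin. There `Re H / Re w`
    -- is nearly at least `c`, and monotonicity carries the bound back to `w`.
    obtain ⟨t, ht0, htR, htκ⟩ : ∃ t : ℝ, 0 ≤ t ∧ |R'| < w.re + t ∧ |w.im| < κ' * (w.re + t) := by
      refine ⟨|R'| + |w.im| / κ', by positivity, ?_, ?_⟩
      · have : 0 ≤ |w.im| / κ' := by positivity
        linarith
      · have : κ' * (w.re + (|R'| + |w.im| / κ')) = κ' * w.re + κ' * |R'| + |w.im| := by
          field_simp
          ring
        rw [this]
        have : 0 < κ' * w.re := by positivity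
        have : 0 ≤ κ' * |R'| := by positivity
        linarith
    have hmem : w + t ∈ sector κ' |R'| := by
      simp only [sector, Set.mem_ofPred_eq, Complex.add_re, Complex.ofReal_re, Complex.add_im,
        Complex.ofReal_im, add_zero]
      exact ⟨htR, htκ⟩
    have h1 := hR' _ (sector_mono (abs_nonneg R') le_rfl (le_abs_self R') hmem)
    have h2 := norm_le_of_mem_sector (abs_nonneg R') hmem
    have h3 := (abs_le.1 (Complex.abs_re_le_norm (H (w + t) - c * (w + t)))).1
    have hre : (w + (t : ℂ)).re = w.re + t := by simp
    have h4 : (H (w + t) - c * (w + t)).re = (H (w + t)).re - c * (w.re + t) := by simp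
    rw [h4] at h3
    rw [hre] at h2
    have hwt : 0 < w.re + t := by positivity
    have h5 : ε / (1 + κ') * ‖w + t‖ ≤ ε * (w.re + t) := by
      calc ε / (1 + κ') * ‖w + t‖ ≤ ε / (1 + κ') * ((1 + κ') * (w.re + t)) := by gcongr
        _ = _ := by field_simp
    have h6 : c - ε ≤ (H (w + t)).re / (w.re + t) := by
      rw [le_div_iff₀ hwt]
      linarith
    have h7 := hH.antitoneOn_re_div_re hw (Set.mem_Ici.2 le_rfl) (Set.mem_Ici.2 ht0) ht0
    simp only [Complex.ofReal_zero, add_zero] at h7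
    exact h6.trans h7
  have : c ≤ (H w).re / w.re := le_of_forall_pos_sub_le key
  rwa [le_div_iff₀ hw0] at this

/-! ### Self-maps of the disk: Schwarz–Pick and Julia -/

open scoped ComplexConjugate

theorem sq_norm_eq (z : ℂ) : ‖z‖ ^ 2 = z.re ^ 2 + z.im ^ 2 := by
  rw [← Complex.normSq_eq_norm_sq, Complex.normSq_apply]; ring

theorem sq_norm_lt_one {z : ℂ} (hz : z ∈ disk) : ‖z‖ ^ 2 < 1 := by
  have : ‖z‖ < 1 := by simpa using hz
  nlinarith [norm_nonneg z]

theorem sq_norm_one_sub_conj_mul (a z : ℂ) :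
    ‖1 - conj a * z‖ ^ 2 = ‖z - a‖ ^ 2 + (1 - ‖a‖ ^ 2) * (1 - ‖z‖ ^ 2) := by
  simp only [sq_norm_eq, Complex.sub_re, Complex.sub_im, Complex.mul_re, Complex.mul_im,
    Complex.conj_re, Complex.conj_im, Complex.one_re, Complex.one_im]
  ring

theorem one_sub_conj_mul_ne_zero {a z : ℂ} (ha : a ∈ disk) (hz : z ∈ disk) :
    1 - conj a * z ≠ 0 := by
  intro h
  have h1 := sq_norm_one_sub_conj_mul a z
  rw [h, norm_zero] at h1
  have := mul_pos (sub_pos.2 (sq_norm_lt_one ha)) (sub_pos.2 (sq_norm_lt_one hz))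
  nlinarith [sq_nonneg ‖z - a‖]

theorem sub_div_one_sub_conj_mul_mem_disk {a z : ℂ} (ha : a ∈ disk) (hz : z ∈ disk) :
    (z - a) / (1 - conj a * z) ∈ disk := by
  have h0 := norm_pos_iff.2 (one_sub_conj_mul_ne_zero ha hz)
  rw [mem_ball_zero_iff, norm_div, div_lt_one h0]
  refine lt_of_pow_lt_pow_left₀ 2 h0.le ?_
  rw [sq_norm_one_sub_conj_mul]
  linarith [mul_pos (sub_pos.2 (sq_norm_lt_one ha)) (sub_pos.2 (sq_norm_lt_one hz))]

theorem blaschkeFactor_mem_disk {a z : ℂ} (ha : a ∈ disk) (hz : z ∈ disk) :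
    blaschkeFactor a z ∈ disk := by
  unfold blaschkeFactor
  split_ifs with h
  · exact hz
  · have h1 := sub_div_one_sub_conj_mul_mem_disk ha hz
    have h2 : ‖a‖ ≠ 0 := norm_ne_zero_iff.2 h
    rw [mem_ball_zero_iff] at h1 ⊢
    rw [norm_mul, norm_div, Complex.norm_real, norm_norm, div_self h2, one_mul, norm_div,
      norm_sub_rev, ← norm_div]
    exact h1

theorem differentiableOn_blaschkeFactor {a : ℂ} (ha : a ∈ disk) :
    DifferentiableOn ℂ (blaschkeFactor a) disk := by
  unfold blaschkeFactor
  split_ifs with h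
  · exact differentiableOn_id
  · refine DifferentiableOn.const_mul ?_ _
    refine DifferentiableOn.div (by fun_prop) (by fun_prop) fun z hz => ?_
    exact one_sub_conj_mul_ne_zero ha hz

/-- Holomorphy passes to the locally uniform limit. Once a partial product includes a fixed index,
the single factor there bounds it; this gives the strict inequality in the limit. -/
theorem IsBlaschkeProduct.isHolSelfMap {B : ℂ → ℂ} (hB : IsBlaschkeProduct B) :
    IsHolSelfMap B := by
  obtain ⟨ι, a, c, P, ⟨i₀⟩, hc, ha, -, hP, hBP⟩ := hB
  have hPd : DifferentiableOn ℂ P disk := by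
    refine (hasProdLocallyUniformlyOn_iff_tendstoLocallyUniformlyOn.1 hP).differentiableOn
      (Eventually.of_forall fun s => ?_) Metric.isOpen_ball
    exact DifferentiableOn.fun_finsetProd fun i _ => differentiableOn_blaschkeFactor (ha i)
  refine ⟨(hPd.const_mul c).congr fun z hz => hBP z hz, fun z hz => ?_⟩
  have hle : ‖P z‖ ≤ ‖blaschkeFactor (a i₀) z‖ := by
    refine le_of_tendsto (hP.hasProd hz).norm ?_
    filter_upwards [eventually_ge_atTop {i₀}] with s hs
    classical
    rw [← Finset.mul_prod_erase s _ (hs (Finset.mem_singleton_self i₀))]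
    refine mul_le_of_le_one_right (norm_nonneg _) (Finset.prod_le_one (fun _ _ => norm_nonneg _)
      fun i _ => ?_)
    exact (mem_ball_zero_iff.1 (blaschkeFactor_mem_disk (ha i) hz)).le
  rw [mem_ball_zero_iff, hBP z hz, norm_mul, hc, one_mul]
  exact hle.trans_lt (mem_ball_zero_iff.1 (blaschkeFactor_mem_disk (ha i₀) hz))

namespace IsHolSelfMap

variable {f : ℂ → ℂ}

/-- The Schwarz–Pick lemma. -/
theorem schwarz_pick (hf : IsHolSelfMap f) {z w : ℂ} (hz : z ∈ disk) (hw : w ∈ disk) :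
    ‖f z - f w‖ * ‖1 - conj w * z‖ ≤ ‖z - w‖ * ‖1 - conj (f w) * f z‖ := by
  -- Disk automorphisms move `w` and `f w` to 0, where the Schwarz lemma applies.
  set T : ℂ → ℂ := fun ζ => (ζ + w) / (1 + conj w * ζ) with hT
  have hnw : -w ∈ disk := by simpa using hw
  have hTne : ∀ ζ ∈ disk, 1 + conj w * ζ ≠ 0 := fun ζ hζ => by
    simpa using one_sub_conj_mul_ne_zero hnw hζ
  have hTm : Set.MapsTo T disk disk := fun ζ hζ => by
    simpa [hT] using sub_div_one_sub_conj_mul_mem_disk hnw hζ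
  have hTd : DifferentiableOn ℂ T disk :=
    DifferentiableOn.div (by fun_prop) (by fun_prop) hTne
  have hfw := hf.2 hw
  set g : ℂ → ℂ := fun ζ => (f (T ζ) - f w) / (1 - conj (f w) * f (T ζ)) with hg
  have hfT : DifferentiableOn ℂ (fun ζ => f (T ζ)) disk := hf.1.comp hTd hTm
  have hgd : DifferentiableOn ℂ g disk :=
    (hfT.sub_const _).div ((hfT.const_mul _).const_sub _) fun ζ hζ =>
      one_sub_conj_mul_ne_zero hfw (hf.2 (hTm hζ))
  have hgm : Set.MapsTo g disk (Metric.closedBall 0 1) := fun ζ hζ =>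
    Metric.ball_subset_closedBall (sub_div_one_sub_conj_mul_mem_disk hfw (hf.2 (hTm hζ)))
  have hg0 : g 0 = 0 := by simp [hg, hT]
  set ζ := (z - w) / (1 - conj w * z) with hζ
  have hζm : ζ ∈ disk := sub_div_one_sub_conj_mul_mem_disk hw hz
  have hne := one_sub_conj_mul_ne_zero hw hz
  have hTζ : T ζ = z := by
    have h1 := hTne ζ hζm
    have h2 : ζ * (1 - conj w * z) = z - w := div_mul_cancel₀ _ hne
    simp only [hT]
    rw [div_eq_iff h1]
    linear_combination h2
  have h := Complex.norm_le_norm_of_mapsTo_ball hgd hgm hg0 (mem_ball_zero_iff.1 hζm)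
  simp only [hg, hTζ] at h
  rw [norm_div, hζ, norm_div, div_le_div_iff₀
    (norm_pos_iff.2 (one_sub_conj_mul_ne_zero hfw (hf.2 hz))) (norm_pos_iff.2 hne)] at h
  exact h

/-- This form displays the factors `1 - |z|²` and `1 - |f z|²`, whose ratio is what the dilation
controls as `z` approaches the boundary. -/
theorem schwarz_pick_mul (hf : IsHolSelfMap f) {z w : ℂ} (hz : z ∈ disk) (hw : w ∈ disk) :
    (1 - ‖w‖ ^ 2) * (1 - ‖z‖ ^ 2) * ‖1 - conj (f w) * f z‖ ^ 2 ≤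
      (1 - ‖f w‖ ^ 2) * (1 - ‖f z‖ ^ 2) * ‖1 - conj w * z‖ ^ 2 := by
  have h := pow_le_pow_left₀ (by positivity) (hf.schwarz_pick hz hw) 2
  rw [mul_pow, mul_pow] at h
  have h1 := sq_norm_one_sub_conj_mul w z
  have h2 := sq_norm_one_sub_conj_mul (f w) (f z)
  have h3 : ‖z - w‖ ^ 2 = ‖1 - conj w * z‖ ^ 2 - (1 - ‖w‖ ^ 2) * (1 - ‖z‖ ^ 2) := by linarith
  have h4 : ‖f z - f w‖ ^ 2 = ‖1 - conj (f w) * f z‖ ^ 2 - (1 - ‖f w‖ ^ 2) * (1 - ‖f z‖ ^ 2) := by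
    linarith
  rw [h3, h4] at h
  linarith

theorem differentiableAt (hf : IsHolSelfMap f) {z : ℂ} (hz : z ∈ disk) : DifferentiableAt ℂ f z :=
  hf.1.differentiableAt (Metric.isOpen_ball.mem_nhds hz)

theorem norm_deriv_div_le (hf : IsHolSelfMap f) {w : ℂ} (hw : w ∈ disk) :
    ‖deriv f w‖ / (1 - ‖f w‖ ^ 2) ≤ 1 / (1 - ‖w‖ ^ 2) := by
  have hfd := hf.differentiableAt hw
  have h1 : Tendsto (fun z => ‖slope f w z‖ * ‖1 - conj w * z‖) (𝓝[≠] w)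
      (𝓝 (‖deriv f w‖ * ‖1 - conj w * w‖)) := by
    refine (hasDerivAt_iff_tendsto_slope.1 hfd.hasDerivAt).norm.mul ?_
    have : Continuous fun z => ‖1 - conj w * z‖ := by fun_prop
    exact this.continuousAt.tendsto.mono_left nhdsWithin_le_nhds
  have h2 : Tendsto (fun z => ‖1 - conj (f w) * f z‖) (𝓝[≠] w) (𝓝 ‖1 - conj (f w) * f w‖) :=
    ((hfd.continuousAt.tendsto.const_mul _).const_sub _).norm.mono_left nhdsWithin_le_nhds
  have h3 : ‖deriv f w‖ * ‖1 - conj w * w‖ ≤ ‖1 - conj (f w) * f w‖ := by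
    refine le_of_tendsto_of_tendsto h1 h2 ?_
    filter_upwards [self_mem_nhdsWithin,
      mem_nhdsWithin_of_mem_nhds (Metric.isOpen_ball.mem_nhds hw)] with z hzw hz
    have hzw' : 0 < ‖z - w‖ := norm_pos_iff.2 (sub_ne_zero.2 hzw)
    have h := hf.schwarz_pick hz hw
    rw [slope_def_field, norm_div, div_mul_eq_mul_div, div_le_iff₀ hzw']
    linarith
  have h4 : ∀ u ∈ disk, ‖1 - conj u * u‖ = 1 - ‖u‖ ^ 2 := fun u hu => by
    have : 1 - conj u * u = ((1 - ‖u‖ ^ 2 : ℝ) : ℂ) := by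
      rw [Complex.conj_mul']; push_cast; rfl
    rw [this, Complex.norm_real, Real.norm_of_nonneg (sub_nonneg.2 (sq_norm_lt_one hu).le)]
  rw [h4 w hw, h4 _ (hf.2 hw)] at h3
  rw [div_le_div_iff₀ (sub_pos.2 (sq_norm_lt_one (hf.2 hw))) (sub_pos.2 (sq_norm_lt_one hw))]
  linarith

/-- Julia's lemma on the radius. -/
theorem exists_julia (hf : IsHolSelfMap f) (hα : boundaryDilation f 1 < ⊤)
    (hrad : Tendsto (fun x : ℝ => f x) (𝓝[<] 1) (𝓝 1)) :
    ∃ C : ℝ, 0 < C ∧ ∀ x : ℝ, 0 < x → x < 1 →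
      (1 - x ^ 2) * ‖1 - f x‖ ^ 2 ≤ C * ((1 - ‖f x‖ ^ 2) * (1 - x) ^ 2) := by
  obtain ⟨C, hC, hCtop⟩ := exists_between hα
  have hC0 : 0 < C.toReal := ENNReal.toReal_pos (by rintro rfl; simp at hC) hCtop.ne
  have hfreq : ∃ᶠ z in 𝓝[disk] (1 : ℂ),
      ENNReal.ofReal ((1 - ‖f z‖) / (1 - ‖z‖)) < C ∧ z ∈ disk :=
    (frequently_lt_of_liminf_lt (by isBoundedDefault) hC).and_eventually self_mem_nhdsWithin
  -- The points `ζ n` tend to 1 with dilation quotient below `C`; by compactness their images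
  -- accumulate at some `σ`, a priori unrelated to the radial limit.
  obtain ⟨ζ, hζ, hζC⟩ := exists_seq_forall_of_frequently hfreq
  obtain ⟨σ, -, φ, hφ, hσ⟩ := (isCompact_closedBall (0 : ℂ) 1).tendsto_subseq
    (x := fun n => f (ζ n)) fun n => Metric.ball_subset_closedBall (hf.2 (hζC n).2)
  have hζ1 : Tendsto (fun n => ζ (φ n)) atTop (𝓝 1) :=
    (tendsto_nhds_of_tendsto_nhdsWithin hζ).comp hφ.tendsto_atTop
  have hdisk : ∀ x : ℝ, 0 < x → x < 1 → (x : ℂ) ∈ disk := fun x hx0 hx1 => by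
    simp [abs_of_pos hx0, hx1]
  have key : ∀ x : ℝ, 0 < x → x < 1 →
      (1 - x ^ 2) * ‖1 - conj σ * f x‖ ^ 2 ≤ 2 * C.toReal * ((1 - ‖f x‖ ^ 2) * (1 - x) ^ 2) := by
    intro x hx0 hx1
    have hstep : ∀ n, (1 - x ^ 2) * ‖1 - conj (f (ζ (φ n))) * f x‖ ^ 2 ≤
        2 * C.toReal * ((1 - ‖f x‖ ^ 2) * ‖1 - conj (ζ (φ n)) * x‖ ^ 2) := by
      intro n
      obtain ⟨hn1, hn2⟩ := hζC (φ n)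
      set z := ζ (φ n)
      have hz1 : ‖z‖ < 1 := mem_ball_zero_iff.1 hn2
      have hfz1 : ‖f z‖ < 1 := mem_ball_zero_iff.1 (hf.2 hn2)
      rw [ENNReal.ofReal_lt_iff_lt_toReal
        (div_nonneg (by linarith) (by linarith)) hCtop.ne, div_lt_iff₀ (by linarith)] at hn1
      have h1 := hf.schwarz_pick_mul (hdisk x hx0 hx1) hn2
      rw [Complex.norm_real, Real.norm_of_nonneg hx0.le] at h1
      have h2 : 1 - ‖f z‖ ^ 2 ≤ 2 * C.toReal * (1 - ‖z‖ ^ 2) := by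
        have h3 : 1 - ‖f z‖ ^ 2 ≤ 2 * (1 - ‖f z‖) := by nlinarith [norm_nonneg (f z)]
        have h4 : 1 - ‖z‖ ≤ 1 - ‖z‖ ^ 2 := by nlinarith [norm_nonneg z]
        nlinarith
      have h5 : 0 < 1 - ‖z‖ ^ 2 := sub_pos.2 (sq_norm_lt_one hn2)
      have h6 : 0 < 1 - ‖f x‖ ^ 2 := sub_pos.2 (sq_norm_lt_one (hf.2 (hdisk x hx0 hx1)))
      refine le_of_mul_le_mul_left ?_ h5
      calc (1 - ‖z‖ ^ 2) * ((1 - x ^ 2) * ‖1 - conj (f z) * f x‖ ^ 2)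
          ≤ (1 - ‖f z‖ ^ 2) * (1 - ‖f x‖ ^ 2) * ‖1 - conj z * x‖ ^ 2 := by linarith
        _ ≤ 2 * C.toReal * (1 - ‖z‖ ^ 2) * (1 - ‖f x‖ ^ 2) * ‖1 - conj z * x‖ ^ 2 := by gcongr
        _ = _ := by ring
    have hl : Tendsto (fun n => (1 - x ^ 2) * ‖1 - conj (f (ζ (φ n))) * f x‖ ^ 2) atTop
        (𝓝 ((1 - x ^ 2) * ‖1 - conj σ * f x‖ ^ 2)) :=
      (((((Complex.continuous_conj.tendsto σ).comp hσ).mul_const _).const_sub _).norm.pow 2).const_mul _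
    have hr : Tendsto (fun n => 2 * C.toReal * ((1 - ‖f x‖ ^ 2) * ‖1 - conj (ζ (φ n)) * x‖ ^ 2)) atTop
        (𝓝 (2 * C.toReal * ((1 - ‖f x‖ ^ 2) * ‖1 - conj (1 : ℂ) * x‖ ^ 2))) :=
      ((((((Complex.continuous_conj.tendsto 1).comp hζ1).mul_const _).const_sub _).norm.pow
        2).const_mul _).const_mul _
    have hlim := le_of_tendsto_of_tendsto' hl hr hstep
    have h7 : ‖1 - conj (1 : ℂ) * x‖ = 1 - x := by
      rw [map_one, one_mul, ← Complex.ofReal_one, ← Complex.ofReal_sub, Complex.norm_real,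
        Real.norm_of_nonneg (by linarith)]
    rwa [h7] at hlim
  -- Dividing the inequality `key` by `1 - x` and letting `x → 1` forces the radial limit 1 to
  -- satisfy `|1 - conj σ| = 0`.
  have hσ1 : σ = 1 := by
    have hl : Tendsto (fun x : ℝ => ‖1 - conj σ * f x‖ ^ 2) (𝓝[<] 1)
        (𝓝 (‖1 - conj σ * 1‖ ^ 2)) :=
      ((hrad.const_mul _).const_sub _).norm.pow 2
    have hr : Tendsto (fun x : ℝ => 2 * C.toReal * (1 - x)) (𝓝[<] 1)
        (𝓝 (2 * C.toReal * (1 - 1))) := by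
      refine Tendsto.mono_left ?_ nhdsWithin_le_nhds
      exact (Continuous.tendsto (by fun_prop) 1)
    have h8 : ‖1 - conj σ * 1‖ ^ 2 ≤ 2 * C.toReal * (1 - 1) := by
      refine le_of_tendsto_of_tendsto hl hr ?_
      filter_upwards [Ioo_mem_nhdsLT (show (0 : ℝ) < 1 by norm_num)] with x hx
      have h9 := key x hx.1 hx.2
      have h10 : 1 - ‖f x‖ ^ 2 ≤ 1 := by nlinarith [sq_nonneg ‖f x‖]
      have h11 : 0 < 1 - x := by linarith [hx.2]
      refine le_of_mul_le_mul_left ?_ h11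
      calc (1 - x) * ‖1 - conj σ * f x‖ ^ 2 ≤ (1 - x ^ 2) * ‖1 - conj σ * f x‖ ^ 2 := by
            gcongr
            nlinarith [hx.1, hx.2]
        _ ≤ 2 * C.toReal * ((1 - ‖f x‖ ^ 2) * (1 - x) ^ 2) := h9
        _ ≤ 2 * C.toReal * (1 * (1 - x) ^ 2) := by gcongr
        _ = _ := by ring
    have h9 : ‖1 - conj σ * 1‖ = 0 := by
      rw [sub_self, mul_zero] at h8
      exact pow_eq_zero_iff two_ne_zero |>.1 (le_antisymm h8 (by positivity))
    rw [mul_one, norm_eq_zero, sub_eq_zero] at h9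
    have := congrArg conj h9
    simpa using this.symm
  refine ⟨2 * C.toReal, by positivity, fun x hx0 hx1 => ?_⟩
  have := key x hx0 hx1
  rwa [hσ1, map_one, one_mul] at this

end IsHolSelfMap

/-! ### Transfer to the right half-plane -/

/-- The Cayley transform from the unit disk to the right half-plane. -/
noncomputable def cayley (u : ℂ) : ℂ := (1 + u) / (1 - u)

/-- The Cayley transform from the right half-plane to the unit disk. -/
noncomputable def cayleyInv (Z : ℂ) : ℂ := (Z - 1) / (Z + 1)

/-- The self-map of the right half-plane corresponding to the self-map `f` of the disk. -/
noncomputable def halfPlaneMap (f : ℂ → ℂ) (Z : ℂ) : ℂ := cayley (f (cayleyInv Z))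

theorem one_sub_ne_zero {u : ℂ} (hu : u ∈ disk) : 1 - u ≠ 0 := by
  intro h
  rw [← sub_eq_zero.1 h] at hu
  simp at hu

theorem add_one_ne_zero {Z : ℂ} (hZ : 0 < Z.re) : Z + 1 ≠ 0 := by
  intro h
  have := congrArg Complex.re h
  simp at this
  linarith

theorem cayley_re (u : ℂ) : (cayley u).re = (1 - ‖u‖ ^ 2) / ‖1 - u‖ ^ 2 := by
  rw [cayley, Complex.div_re, sq_norm_eq, ← Complex.normSq_eq_norm_sq]
  simp only [Complex.add_re, Complex.sub_re, Complex.add_im, Complex.sub_im, Complex.one_re,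
    Complex.one_im]
  ring

theorem cayley_re_pos {u : ℂ} (hu : u ∈ disk) : 0 < (cayley u).re := by
  rw [cayley_re]
  exact div_pos (sub_pos.2 (sq_norm_lt_one hu)) (pow_pos (norm_pos_iff.2 (one_sub_ne_zero hu)) 2)

theorem cayleyInv_mem_disk {Z : ℂ} (hZ : 0 < Z.re) : cayleyInv Z ∈ disk := by
  have h := norm_pos_iff.2 (add_one_ne_zero hZ)
  rw [mem_ball_zero_iff, cayleyInv, norm_div, div_lt_one h]
  refine lt_of_pow_lt_pow_left₀ 2 h.le ?_
  simp only [sq_norm_eq, Complex.add_re, Complex.sub_re, Complex.add_im, Complex.sub_im,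
    Complex.one_re, Complex.one_im]
  nlinarith

theorem cayley_cayleyInv {Z : ℂ} (hZ : 0 < Z.re) : cayley (cayleyInv Z) = Z := by
  have h := add_one_ne_zero hZ
  have h2 : 1 - cayleyInv Z ≠ 0 := one_sub_ne_zero (cayleyInv_mem_disk hZ)
  rw [cayley, div_eq_iff h2, cayleyInv]
  field_simp
  ring

theorem cayleyInv_cayley {u : ℂ} (hu : u ∈ disk) : cayleyInv (cayley u) = u := by
  have h := one_sub_ne_zero hu
  have h2 := add_one_ne_zero (cayley_re_pos hu)
  rw [cayleyInv, div_eq_iff h2, cayley]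
  field_simp
  ring

theorem one_sub_mul_cayley_add_one {u : ℂ} (hu : u ∈ disk) : (1 - u) * (cayley u + 1) = 2 := by
  have h := one_sub_ne_zero hu
  rw [cayley]
  field_simp
  ring

theorem continuousOn_cayley : ContinuousOn cayley disk :=
  ContinuousOn.div (by fun_prop) (by fun_prop) fun _ hu => one_sub_ne_zero hu

theorem continuousOn_cayleyInv : ContinuousOn cayleyInv {Z | 0 < Z.re} :=
  ContinuousOn.div (by fun_prop) (by fun_prop) fun _ hZ => add_one_ne_zero hZ

theorem IsHolSelfMap.hasDerivAt_halfPlaneMap {f : ℂ → ℂ} (hf : IsHolSelfMap f) {Z : ℂ}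
    (hZ : 0 < Z.re) :
    HasDerivAt (halfPlaneMap f)
      (2 / (1 - f (cayleyInv Z)) ^ 2 * (deriv f (cayleyInv Z) * (2 / (Z + 1) ^ 2))) Z := by
  have hu := cayleyInv_mem_disk hZ
  have h1 : HasDerivAt cayleyInv (2 / (Z + 1) ^ 2) Z := by
    have := ((hasDerivAt_id Z).sub_const 1).div ((hasDerivAt_id Z).add_const 1) (add_one_ne_zero hZ)
    refine this.congr_deriv ?_
    simp only [id]
    ring
  have h2 : HasDerivAt cayley (2 / (1 - f (cayleyInv Z)) ^ 2) (f (cayleyInv Z)) := by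
    have := ((hasDerivAt_id (f (cayleyInv Z))).const_add 1).div
      ((hasDerivAt_id (f (cayleyInv Z))).const_sub 1) (one_sub_ne_zero (hf.2 hu))
    refine this.congr_deriv ?_
    simp only [id]
    ring
  exact h2.comp Z ((hf.differentiableAt hu).hasDerivAt.comp Z h1)

theorem IsHolSelfMap.halfPlaneMap_re_pos {f : ℂ → ℂ} (hf : IsHolSelfMap f) {Z : ℂ}
    (hZ : 0 < Z.re) : 0 < (halfPlaneMap f Z).re :=
  cayley_re_pos (hf.2 (cayleyInv_mem_disk hZ))

/-- The Cayley transform is a hyperbolic isometry, so the conformal factor on the right does not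
depend on `f`. Inequalities between pulled-back metrics therefore transfer unchanged. -/
theorem IsHolSelfMap.norm_deriv_halfPlaneMap_div {f : ℂ → ℂ} (hf : IsHolSelfMap f) {Z : ℂ}
    (hZ : 0 < Z.re) :
    ‖deriv (halfPlaneMap f) Z‖ / (halfPlaneMap f Z).re =
      ‖deriv f (cayleyInv Z)‖ / (1 - ‖f (cayleyInv Z)‖ ^ 2) * (4 / ‖Z + 1‖ ^ 2) := by
  have hu := hf.2 (cayleyInv_mem_disk hZ)
  have h1 := norm_pos_iff.2 (one_sub_ne_zero hu)
  have h2 := sub_pos.2 (sq_norm_lt_one hu)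
  have h3 := norm_pos_iff.2 (add_one_ne_zero hZ)
  rw [(hf.hasDerivAt_halfPlaneMap hZ).deriv, halfPlaneMap, cayley_re]
  simp only [norm_mul, norm_div, norm_pow, Complex.norm_ofNat]
  field_simp
  ring

theorem isHolSelfMap_id : IsHolSelfMap id := ⟨differentiableOn_id, fun _ h => h⟩

theorem IsHolSelfMap.norm_deriv_halfPlaneMap_le {f : ℂ → ℂ} (hf : IsHolSelfMap f) {Z : ℂ}
    (hZ : 0 < Z.re) :
    ‖deriv (halfPlaneMap f) Z‖ ≤ (halfPlaneMap f Z).re / Z.re := by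
  have hid : halfPlaneMap id =ᶠ[𝓝 Z] id := by
    filter_upwards [(isOpen_lt continuous_const Complex.continuous_re).mem_nhds hZ] with W hW
    exact cayley_cayleyInv hW
  -- The identity map evaluates the common conformal factor, leaving Schwarz–Pick in the disk.
  have h1 := isHolSelfMap_id.norm_deriv_halfPlaneMap_div hZ
  rw [hid.deriv_eq, hid.eq_of_nhds, deriv_id, deriv_id, norm_one, id, id] at h1
  have h2 := hf.norm_deriv_halfPlaneMap_div hZ
  have h3 : ‖deriv (halfPlaneMap f) Z‖ / (halfPlaneMap f Z).re ≤ 1 / Z.re := by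
    rw [h1, h2]
    refine mul_le_mul_of_nonneg_right ?_ (by positivity)
    simpa using hf.norm_deriv_div_le (cayleyInv_mem_disk hZ)
  rwa [div_le_iff₀ (hf.halfPlaneMap_re_pos hZ), one_div_mul_eq_div] at h3

/-! ### Inverting a map with positive angular derivative -/

theorem exists_closedBall_subset_sector {κ' κ : ℝ} (hκ' : 0 < κ') (hκ : κ' < κ) :
    ∃ r > 0, ∀ R ≥ 0, ∃ R' ≥ R, ∀ w ∈ sector κ' R', Metric.closedBall w (r * w.re) ⊆ sector κ R := by
  have hκ1 : 0 < 1 + κ := by linarith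
  -- This `r` solves `κ' + r = κ (1 - r)`: moving by `r * w.re` raises the imaginary part by at most
  -- `r * w.re` and leaves a real part of at least `(1 - r) * w.re`.
  refine ⟨(κ - κ') / (1 + κ), div_pos (by linarith) hκ1, fun R hR => ?_⟩
  set r := (κ - κ') / (1 + κ) with hr
  have hr0 : 0 < r := div_pos (by linarith) hκ1
  have hr1 : 0 < 1 - r := by
    rw [sub_pos, hr, div_lt_one hκ1]
    linarith
  have hrκ : κ' + r = κ * (1 - r) := by
    rw [hr]; field_simp; ring
  refine ⟨R / (1 - r), ?_, fun w hw z hz => ?_⟩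
  · rw [ge_iff_le, le_div_iff₀ hr1]
    nlinarith
  · obtain ⟨hw1, hw2⟩ := hw
    rw [div_lt_iff₀ hr1] at hw1
    rw [mem_closedBall_iff_norm] at hz
    have h1 := abs_le.1 ((Complex.abs_re_le_norm (z - w)).trans hz)
    have h2 := (Complex.abs_im_le_norm (z - w)).trans hz
    rw [Complex.sub_re] at h1
    rw [Complex.sub_im] at h2
    have h3 : |z.im| ≤ |w.im| + |z.im - w.im| := by
      have := abs_add_le w.im (z.im - w.im)
      rwa [add_sub_cancel] at this
    have h4 : (1 - r) * w.re ≤ z.re := by linarith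
    refine ⟨by linarith, ?_⟩
    calc |z.im| < κ' * w.re + r * w.re := by linarith
      _ = κ * ((1 - r) * w.re) := by rw [← add_mul, hrκ]; ring
      _ ≤ κ * z.re := by
        have : 0 < κ := hκ'.trans hκ
        gcongr

/-- Angular convergence of `F w / w` to `c` at infinity implies that of the derivative. -/
theorem exists_norm_deriv_sub_le {F : ℂ → ℂ} {c κ κ' : ℝ}
    (hF : DifferentiableOn ℂ F {Z | 0 < Z.re}) (hκ' : 0 < κ') (hκ : κ' < κ)
    (hc : ∀ ε > 0, ∃ R ≥ 0, ∀ w ∈ sector κ R, ‖F w - c * w‖ ≤ ε * ‖w‖) {ε : ℝ} (hε : 0 < ε) :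
    ∃ R ≥ 0, ∀ w ∈ sector κ' R, ‖deriv F w - c‖ ≤ ε := by
  obtain ⟨r, hr, hball⟩ := exists_closedBall_subset_sector hκ' hκ
  have hp : 0 < 1 + κ' + r := by positivity
  obtain ⟨R, hR, hFR⟩ := hc (ε * r / (1 + κ' + r)) (by positivity)
  obtain ⟨R', hR', hsub⟩ := hball R hR
  refine ⟨R', hR.trans hR', fun w hw => ?_⟩
  have hw0 : 0 < w.re := (hR.trans hR').trans_lt hw.1
  have hsubH : ∀ z ∈ Metric.closedBall w (r * w.re), DifferentiableAt ℂ F z := fun z hz =>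
    hF.differentiableAt ((isOpen_lt continuous_const Complex.continuous_re).mem_nhds
      (hR.trans_lt (hsub w hw hz).1))
  have hd : DiffContOnCl ℂ (fun z => F z - c * z) (Metric.ball w (r * w.re)) := by
    refine DifferentiableOn.diffContOnCl_ball (U := sector κ R) (fun z hz => ?_) (hsub w hw)
    exact ((hF.differentiableAt ((isOpen_lt continuous_const Complex.continuous_re).mem_nhds
      (hR.trans_lt hz.1))).sub (differentiableAt_id.const_mul _)).differentiableWithinAt
  -- Cauchy's estimate for `F z - c z`: on a circle of radius proportional to `w.re` the function is
  -- a small multiple of `w.re`.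
  have h1 := Complex.norm_deriv_le_of_forall_mem_sphere_norm_le
    (C := ε * r / (1 + κ' + r) * ((1 + κ' + r) * w.re)) (mul_pos hr hw0) hd fun z hz => by
      refine (hFR z (hsub w hw (Metric.sphere_subset_closedBall hz))).trans ?_
      gcongr
      have h2 := norm_le_of_mem_sector (hR.trans hR') hw
      have h3 : ‖z - w‖ = r * w.re := mem_sphere_iff_norm.1 hz
      have h4 : ‖z‖ ≤ ‖w‖ + ‖z - w‖ := by simpa using norm_add_le w (z - w)
      linarith
  have h2 : deriv (fun z => F z - c * z) w = deriv F w - c := by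
    have h3 : HasDerivAt (fun z => F z - c * z) (deriv F w - c * 1) w :=
      (hsubH w (Metric.mem_closedBall_self (by positivity))).hasDerivAt.sub
        ((hasDerivAt_id w).const_mul (c : ℂ))
    rw [h3.deriv, mul_one]
  rw [h2] at h1
  refine h1.trans_eq ?_
  field_simp

theorem isSimplyConnected_image_of_leftInvOn {X Y : Type*} [TopologicalSpace X] [TopologicalSpace Y]
    {f : X → Y} {g : Y → X} {s : Set X} (hs : IsSimplyConnected s) (hf : ContinuousOn f s)
    (hg : ContinuousOn g (f '' s)) (h : Set.LeftInvOn g f s) : IsSimplyConnected (f '' s) := by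
  have hgm : Set.MapsTo g (f '' s) s := by
    rintro _ ⟨x, hx, rfl⟩
    rwa [h hx]
  let e : s ≃ₜ f '' s :=
    { toFun := (Set.mapsTo_image f s).restrict
      invFun := hgm.restrict
      left_inv := fun x => Subtype.ext (h x.2)
      right_inv := by
        rintro ⟨_, x, hx, rfl⟩
        exact Subtype.ext (congrArg f (h hx))
      continuous_toFun := hf.mapsToRestrict _
      continuous_invFun := hg.mapsToRestrict _ }
  exact e.toHomotopyEquiv.simplyConnectedSpace_iff.1 hs

theorem isSimplyConnected_sector {κ R : ℝ} (hκ : 0 < κ) (hR : 0 ≤ R) :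
    IsSimplyConnected (sector κ R) := by
  have hne : (sector κ R).Nonempty := ⟨_, ofReal_mem_sector hκ hR (lt_add_one R)⟩
  have := (convex_sector κ R).contractibleSpace hne
  exact SimplyConnectedSpace.ofContractible _

/-- A map whose derivative is close to `c` on a truncated sector is a homeomorphism onto its
image there, and the image contains every disk of comparable size. -/
theorem exists_openPartialHomeomorph_sector {F : ℂ → ℂ} {c κ R : ℝ} (hc : 0 < c)
    (hF : ∀ w ∈ sector κ R, DifferentiableAt ℂ F w)
    (hF' : ∀ w ∈ sector κ R, ‖deriv F w - c‖ ≤ c / 2) :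
    ∃ Φ : OpenPartialHomeomorph ℂ ℂ, (Φ : ℂ → ℂ) = F ∧ Φ.source = sector κ R ∧
      ∀ w s, 0 ≤ s → Metric.closedBall w s ⊆ sector κ R →
        Metric.closedBall (F w) (c / 2 * s) ⊆ Φ.target := by
  have hc' : (c : ℂ) ≠ 0 := by exact_mod_cast hc.ne'
  set L : ℂ ≃L[ℂ] ℂ := ContinuousLinearEquiv.unitsEquivAut ℂ (Units.mk0 (c : ℂ) hc') with hL
  have hLa : ∀ x, L x = x * c := fun x => by simp [hL]
  have hLs : ∀ x, L.symm x = x * (c : ℂ)⁻¹ := fun x => by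
    rw [ContinuousLinearEquiv.symm_apply_eq, hLa]
    field_simp
  have hk : (((c / 2).toNNReal : NNReal) : ℝ) = c / 2 := Real.coe_toNNReal _ (by positivity)
  -- By convexity of the sector, `F` differs from multiplication by `c` by a `c / 2`-Lipschitz map.
  -- Hence it is injective and covers balls with constant `c - c / 2`.
  have happ : ApproximatesLinearOn F (L : ℂ →L[ℂ] ℂ) (sector κ R) (c / 2).toNNReal := by
    intro x hx y hy
    have hd : ∀ w ∈ sector κ R, HasDerivWithinAt (fun z => F z - z * c) (deriv F w - 1 * c)
        (sector κ R) w := fun w hw =>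
      ((hF w hw).hasDerivAt.sub ((hasDerivAt_id w).mul_const (c : ℂ))).hasDerivWithinAt
    have h := (convex_sector κ R).norm_image_sub_le_of_norm_hasDerivWithin_le hd
      (fun w hw => by rw [one_mul]; exact hF' w hw) hy hx
    have h2 : F x - F y - L (x - y) = F x - x * c - (F y - y * c) := by rw [hLa]; ring
    change ‖F x - F y - L (x - y)‖ ≤ _
    rwa [h2, hk]
  have hN : ‖(L.symm : ℂ →L[ℂ] ℂ)‖ ≤ c⁻¹ := by
    refine ContinuousLinearMap.opNorm_le_bound _ (by positivity) fun x => ?_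
    change ‖L.symm x‖ ≤ _
    rw [hLs, norm_mul, norm_inv, Complex.norm_real, Real.norm_of_nonneg hc.le, mul_comm]
  have hNpos : 0 < ‖(L.symm : ℂ →L[ℂ] ℂ)‖ := by
    refine norm_pos_iff.2 fun h => ?_
    have := congrArg (fun T : ℂ →L[ℂ] ℂ => T 1) h
    change L.symm 1 = 0 at this
    rw [hLs, one_mul] at this
    exact inv_ne_zero hc' this
  have hcN : c ≤ ‖(L.symm : ℂ →L[ℂ] ℂ)‖⁻¹ := by
    rw [le_inv_comm₀ hc hNpos]
    exact hN
  have hlt : (c / 2).toNNReal < ‖(L.symm : ℂ →L[ℂ] ℂ)‖₊⁻¹ := by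
    rw [← NNReal.coe_lt_coe, hk]
    change c / 2 < ‖(L.symm : ℂ →L[ℂ] ℂ)‖⁻¹
    linarith
  refine ⟨happ.toOpenPartialHomeomorph F _ (Or.inr hlt) (isOpen_sector κ R), rfl, rfl,
    fun w s hs hsub => ?_⟩
  refine Set.Subset.trans (Metric.closedBall_subset_closedBall ?_)
    (happ.closedBall_subset_target (Or.inr hlt) (isOpen_sector κ R) hs hsub)
  change c / 2 * s ≤ (‖(L.symm : ℂ →L[ℂ] ℂ)‖⁻¹ - (c / 2).toNNReal) * s
  rw [hk]
  gcongr
  linarith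

/-! ### Comparison of two maps of the half-plane -/

/-- The half-plane form of the main result: comparison of two self-maps `F`, `K` of the right
half-plane such that `K` contracts the metric pulled back by `F`, where `F` has a positive angular
derivative at infinity. -/
theorem exists_simplyConnected_julia {F K : ℂ → ℂ} {κ₀ c₀ : ℝ}
    (hF : DifferentiableOn ℂ F {Z | 0 < Z.re}) (hK : DifferentiableOn ℂ K {Z | 0 < Z.re})
    (hFpos : ∀ Z : ℂ, 0 < Z.re → 0 < (F Z).re) (hKpos : ∀ Z : ℂ, 0 < Z.re → 0 < (K Z).re)
    (hF' : ∀ Z : ℂ, 0 < Z.re → ‖deriv F Z‖ ≤ (F Z).re / Z.re)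
    (hKF : ∀ Z : ℂ, 0 < Z.re → ‖deriv K Z‖ / (K Z).re ≤ ‖deriv F Z‖ / (F Z).re)
    (hc₀ : 0 < c₀) (hFc₀ : ∀ᶠ x : ℝ in atTop, c₀ * x ≤ (F x).re) (hκ₀ : 0 < κ₀) :
    ∃ c b : ℝ, 0 < c ∧ 0 ≤ b ∧
      (∀ ε > 0, ∃ R ≥ 0, ∀ Z ∈ sector κ₀ R, ‖F Z - c * Z‖ ≤ ε * ‖Z‖ ∧
        ‖K Z - b * F Z‖ ≤ ε * ‖F Z‖ ∧ F Z ∈ sector (κ₀ + 1) 0) ∧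
      ∃ V ⊆ {Z : ℂ | 0 < Z.re}, IsOpen V ∧ IsSimplyConnected V ∧
        (∃ R ≥ 0, sector κ₀ R ⊆ V) ∧ ∀ Z ∈ V, b * (F Z).re ≤ (K Z).re := by
  have hopen : IsOpen {Z : ℂ | 0 < Z.re} := isOpen_lt continuous_const Complex.continuous_re
  -- The slope drops by 1 at each stage: `κ₀ + 5` for `F` as a contraction, `κ₀ + 4` for `F Z / Z →
  -- c`, `κ₀ + 3` for `F'` near `c` and the inverse, `κ₀ + 2` for the sector inside the image, and
  -- `κ₀ + 1` for the limit of `K ∘ F⁻¹`, a sector that receives `F Z` for `Z` of slope `κ₀`.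
  have hFs : IsContractionOnSector F (κ₀ + 5) 0 :=
    ⟨by positivity, le_rfl, hF.mono fun Z hZ => hZ.1, fun Z hZ => hFpos Z hZ.1,
      fun Z hZ => hF' Z hZ.1⟩
  obtain ⟨c, hc0, hcF⟩ := hFs.exists_angular_derivative
  have hcF' := hcF (κ₀ + 4) (by linarith)
  have hc : 0 < c := by
    obtain ⟨R, hR0, hR⟩ := hcF' (c₀ / 2) (by positivity)
    obtain ⟨x, hx1, hx2⟩ := (hFc₀.and (eventually_gt_atTop R)).exists
    have h1 := hR x (ofReal_mem_sector (by positivity) hR0 hx2)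
    have hx0 : 0 < x := hR0.trans_lt hx2
    have h2 := (Complex.re_le_norm _).trans h1
    rw [Complex.norm_real, Real.norm_of_nonneg hx0.le] at h2
    have h3 : (F x - c * x).re = (F x).re - c * x := by simp
    rw [h3] at h2
    by_contra h
    nlinarith
  have hcF₂ : ∀ κ ≤ κ₀ + 4, ∀ ε > 0, ∃ R ≥ 0, ∀ w ∈ sector κ R, ‖F w - c * w‖ ≤ ε * ‖w‖ := by
    intro κ hκ ε hε
    obtain ⟨R, hR0, hR⟩ := hcF' ε hε
    exact ⟨R, hR0, fun w hw => hR w (sector_mono hR0 hκ le_rfl hw)⟩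
  obtain ⟨R₃, hR₃, hd₃⟩ := exists_norm_deriv_sub_le hF (show 0 < κ₀ + 3 by positivity)
    (show κ₀ + 3 < κ₀ + 4 by linarith) (hcF₂ _ le_rfl) (half_pos hc)
  obtain ⟨Φ, hΦF, hΦs, hΦt⟩ := exists_openPartialHomeomorph_sector hc
    (fun w hw => hF.differentiableAt (hopen.mem_nhds (hR₃.trans_lt hw.1))) hd₃
  have hΦpos : ∀ Z ∈ Φ.source, 0 < Z.re := fun Z hZ => by
    rw [hΦs] at hZ
    exact hR₃.trans_lt hZ.1
  have hΦd : ∀ Z ∈ Φ.source, deriv F Z ≠ 0 := fun Z hZ h => by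
    rw [hΦs] at hZ
    have := hd₃ Z hZ
    rw [h, zero_sub, norm_neg, Complex.norm_real, Real.norm_of_nonneg hc.le] at this
    linarith
  -- The image of `Φ` contains a truncated sector.
  obtain ⟨R₂, hR₂, htarget⟩ : ∃ R₂ ≥ 0, sector (κ₀ + 2) R₂ ⊆ Φ.target := by
    obtain ⟨r, hr, hball⟩ := exists_closedBall_subset_sector (show 0 < κ₀ + 2 by positivity)
      (show κ₀ + 2 < κ₀ + 3 by linarith)
    obtain ⟨R', hR', hsub⟩ := hball R₃ hR₃
    obtain ⟨R'', hR'', hFc⟩ := hcF₂ (κ₀ + 2) (by linarith) (c / 2 * r / (1 + (κ₀ + 2)))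
      (by positivity)
    refine ⟨c * max R' R'', by positivity, fun W hW => ?_⟩
    have hc' : (c : ℂ) ≠ 0 := by exact_mod_cast hc.ne'
    -- Since `F Z` is close to `c Z = W`, the ball about `F Z` covered by the image of `Φ` already
    -- contains `W`.
    set Z : ℂ := ((c⁻¹ : ℝ) : ℂ) * W with hZ
    have hWZ : W = c * Z := by
      rw [hZ]; push_cast; field_simp
    have hZmem : Z ∈ sector (κ₀ + 2) (max R' R'') := by
      rw [hWZ] at hW
      obtain ⟨h1, h2⟩ := hW
      rw [Complex.re_ofReal_mul] at h1 h2
      rw [Complex.im_ofReal_mul, abs_mul, abs_of_pos hc, mul_left_comm] at h2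
      exact ⟨lt_of_mul_lt_mul_left h1 hc.le, lt_of_mul_lt_mul_left h2 hc.le⟩
    have hR'0 : 0 ≤ max R' R'' := le_max_of_le_right hR''
    have hZ0 : 0 < Z.re := hR'0.trans_lt hZmem.1
    refine hΦt Z (r * Z.re) (by positivity)
      (hsub Z (sector_mono hR'0 le_rfl (le_max_left _ _) hZmem)) ?_
    rw [mem_closedBall_iff_norm, norm_sub_rev, hWZ]
    refine (hFc Z (sector_mono hR'0 le_rfl (le_max_right _ _) hZmem)).trans ?_
    calc c / 2 * r / (1 + (κ₀ + 2)) * ‖Z‖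
        ≤ c / 2 * r / (1 + (κ₀ + 2)) * ((1 + (κ₀ + 2)) * Z.re) := by
          gcongr
          exact norm_le_of_mem_sector hR'0 hZmem
      _ = c / 2 * (r * Z.re) := by field_simp
  have hsymm : ∀ W ∈ sector (κ₀ + 2) R₂, Φ.symm W ∈ Φ.source ∧ F (Φ.symm W) = W := fun W hW =>
    ⟨Φ.map_target (htarget hW), by rw [← hΦF]; exact Φ.right_inv (htarget hW)⟩
  have hderiv : ∀ W ∈ sector (κ₀ + 2) R₂, HasDerivAt (fun W => K (Φ.symm W))
      (deriv K (Φ.symm W) * (deriv F (Φ.symm W))⁻¹) W := by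
    intro W hW
    obtain ⟨h1, -⟩ := hsymm W hW
    have h2 : HasDerivAt Φ (deriv F (Φ.symm W)) (Φ.symm W) := by
      rw [hΦF]
      exact (hF.differentiableAt (hopen.mem_nhds (hΦpos _ h1))).hasDerivAt
    exact (hK.differentiableAt (hopen.mem_nhds (hΦpos _ h1))).hasDerivAt.comp W
      (Φ.hasDerivAt_symm (htarget hW) (hΦd _ h1) h2)
  -- By the chain rule, the comparison of the metrics pulled back by `K` and `F` is exactly the
  -- contraction property of `K ∘ F⁻¹`.
  have hH : IsContractionOnSector (fun W => K (Φ.symm W)) (κ₀ + 2) R₂ := by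
    refine ⟨by positivity, hR₂, fun W hW => (hderiv W hW).differentiableAt.differentiableWithinAt,
      fun W hW => hKpos _ (hΦpos _ (hsymm W hW).1), fun W hW => ?_⟩
    obtain ⟨h1, h2⟩ := hsymm W hW
    rw [(hderiv W hW).deriv, norm_mul, norm_inv]
    have h3 := hKF _ (hΦpos _ h1)
    have h4 := hKpos _ (hΦpos _ h1)
    have h5 := hFpos _ (hΦpos _ h1)
    have h6 := norm_pos_iff.2 (hΦd _ h1)
    rw [h2] at h3 h5
    rw [div_le_div_iff₀ h4 h5] at h3
    rw [← div_eq_mul_inv, div_le_div_iff₀ h6 h5]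
    linarith
  obtain ⟨b, hb0, hb⟩ := hH.exists_angular_derivative
  have hb₁ := hb (κ₀ + 1) (by linarith)
  -- `F` maps thin truncated sectors into slightly wider ones.
  have hmaps : ∀ S : ℝ, ∃ R ≥ R₃, ∀ Z ∈ sector κ₀ R, F Z ∈ sector (κ₀ + 1) S := by
    intro S
    -- The factor `1 + κ₀` converts `‖Z‖` into `Z.re`, so the error is at most `q * Z.re` with `q =
    -- c / (2 * (κ₀ + 3))`. The slope `κ₀ + 1` is then reached because `q * (κ₀ + 2) ≤ c`.
    set δ := c / (2 * (κ₀ + 3) * (1 + κ₀)) with hδ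
    have hδ0 : 0 < δ := by positivity
    obtain ⟨R, hR0, hR⟩ := hcF₂ κ₀ (by linarith) δ hδ0
    refine ⟨max R₃ (max R (2 * |S| / c)), le_max_left _ _, fun Z hZ => ?_⟩
    have hM0 : 0 ≤ max R₃ (max R (2 * |S| / c)) := le_max_of_le_left hR₃
    have hZ0 : 0 < Z.re := hM0.trans_lt hZ.1
    have h1 := hR Z (sector_mono hM0 le_rfl (le_max_of_le_right (le_max_left _ _)) hZ)
    have h2 : ‖F Z - c * Z‖ ≤ c / (2 * (κ₀ + 3)) * Z.re := by
      refine h1.trans ?_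
      calc δ * ‖Z‖ ≤ δ * ((1 + κ₀) * Z.re) := by
            gcongr; exact norm_le_of_mem_sector hM0 hZ
        _ = _ := by rw [hδ]; field_simp
    have h3 := abs_le.1 ((Complex.abs_re_le_norm _).trans h2)
    have h4 := (Complex.abs_im_le_norm _).trans h2
    rw [Complex.sub_re, Complex.re_ofReal_mul] at h3
    rw [Complex.sub_im, Complex.im_ofReal_mul] at h4
    have h5 : |(F Z).im| ≤ c * |Z.im| + |(F Z).im - c * Z.im| := by
      have := abs_add_le (c * Z.im) ((F Z).im - c * Z.im)
      rwa [add_sub_cancel, abs_mul, abs_of_pos hc] at this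
    have h6 : 2 * |S| / c < Z.re := (le_max_of_le_right (le_max_right _ _)).trans_lt hZ.1
    rw [div_lt_iff₀ hc] at h6
    set q := c / (2 * (κ₀ + 3)) with hq
    have hq0 : 0 < q := by positivity
    have hqc : q * (2 * (κ₀ + 3)) = c := by rw [hq]; field_simp
    have hq2 : q ≤ c / 2 := by nlinarith
    refine ⟨?_, ?_⟩
    · have := le_abs_self S
      nlinarith
    · have h7 : c * |Z.im| < c * (κ₀ * Z.re) := by
        have := hZ.2
        gcongr
      have h8 : q * Z.re * (κ₀ + 2) ≤ c * Z.re := by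
        rw [← hqc]
        have : 0 < q * Z.re := by positivity
        nlinarith
      nlinarith
  refine ⟨c, b, hc, hb0, fun ε hε => ?_, Φ.source ∩ Φ ⁻¹' sector (κ₀ + 2) R₂,
    fun Z hZ => hΦpos Z hZ.1, Φ.isOpen_inter_preimage (isOpen_sector _ _), ?_, ?_, ?_⟩
  · obtain ⟨Ra, hRa0, hRa⟩ := hcF₂ κ₀ (by linarith) ε hε
    obtain ⟨Rb, hRb2, hRb⟩ := hb₁ ε hε
    have hRb0 : 0 ≤ Rb := hR₂.trans hRb2
    obtain ⟨Rc, hRc0, hRc⟩ := hmaps Rb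
    have hM : 0 ≤ max Ra Rc := le_max_of_le_left hRa0
    refine ⟨max Ra Rc, hM, fun Z hZ => ⟨hRa Z (sector_mono hM le_rfl (le_max_left _ _) hZ), ?_⟩⟩
    have hZc : Z ∈ sector κ₀ Rc := sector_mono hM le_rfl (le_max_right _ _) hZ
    have h1 := hRb _ (hRc Z hZc)
    have h2 : Z ∈ Φ.source := by
      rw [hΦs]
      exact sector_mono (hR₃.trans hRc0) (by linarith) hRc0 hZc
    have h3 : Φ.symm (F Z) = Z := by rw [← hΦF]; exact Φ.left_inv h2
    simp only [h3] at h1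
    exact ⟨h1, sector_mono hRb0 le_rfl hRb0 (hRc Z hZc)⟩
  · rw [← Φ.symm_image_eq_source_inter_preimage htarget]
    refine isSimplyConnected_image_of_leftInvOn (g := Φ)
      (isSimplyConnected_sector (by positivity) hR₂) (Φ.continuousOn_symm.mono htarget) ?_
      fun W hW => Φ.right_inv (htarget hW)
    refine Φ.continuousOn.mono ?_
    rintro _ ⟨W, hW, rfl⟩
    exact (hsymm W hW).1
  · obtain ⟨Rc, hRc0, hRc⟩ := hmaps R₂
    refine ⟨Rc, hR₃.trans hRc0, fun Z hZ => ⟨?_, ?_⟩⟩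
    · rw [hΦs]
      exact sector_mono (hR₃.trans hRc0) (by linarith) hRc0 hZ
    · rw [Set.mem_preimage, hΦF]
      exact sector_mono hR₂ (by linarith) le_rfl (hRc Z hZ)
  · rintro Z ⟨hZ1, hZ2⟩
    have h := hH.mul_re_le ⟨κ₀ + 1, by positivity, fun ε hε => by
      obtain ⟨R, -, hR⟩ := hb₁ ε hε
      exact ⟨R, hR⟩⟩ hZ2
    rw [Φ.left_inv hZ1, hΦF] at h
    exact h

/-! ### Non-tangential approach in half-plane coordinates -/

/-- Stolz regions become sectors. With `k = tanh (m / 2)` and `D = |1 - conj z t|`, pseudohyperbolic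
distance at most `k` from `t` gives `(1 - k²) D² ≤ (1 - |z|²)(1 - t²)`; combined with `|Im z| ≤ D`
and `(1 - t²)/2 ≤ D`, this bounds `|Im z|` by a multiple of `1 - |z|²`. The extra 1 in the slope
makes the inequality strict. -/
theorem exists_abs_im_cayley_lt (m : ℝ) :
    ∃ κ > 0, ∀ z ∈ stolzRegion m 1, |(cayley z).im| < κ * (cayley z).re := by
  set k := Real.tanh (m / 2) with hk
  have hk2 : 0 < 1 - k ^ 2 := by
    have h1 := Real.tanh_lt_one (m / 2)
    have h2 := Real.neg_one_lt_tanh (m / 2)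
    nlinarith
  refine ⟨4 / (1 - k ^ 2) + 1, by positivity, ?_⟩
  rintro z ⟨hz, w, ⟨t, ht1, ht2, rfl⟩, hd⟩
  rw [mul_one] at hd
  have ht : (t : ℂ) ∈ disk := by
    rw [mem_ball_zero_iff, Complex.norm_real, Real.norm_eq_abs, abs_lt]
    exact ⟨ht1, ht2⟩
  set q := ‖(z - t) / (1 - conj z * t)‖ with hq
  have hq1 : q < 1 := by
    have := mem_ball_zero_iff.1 (sub_div_one_sub_conj_mul_mem_disk hz ht)
    rwa [hq, norm_div, norm_sub_rev, ← norm_div]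
  have hq0 : 0 ≤ q := norm_nonneg _
  have hqk : q ≤ k := by
    have h1 : Real.artanh q ≤ m / 2 := by
      rw [hypDist, ← hq] at hd
      linarith
    rwa [← Real.artanh_tanh (m / 2), Real.artanh_le_artanh_iff ⟨by linarith, hq1⟩
      ⟨Real.neg_one_lt_tanh _, Real.tanh_lt_one _⟩] at h1
  have hD := norm_pos_iff.2 (one_sub_conj_mul_ne_zero hz ht)
  set D := ‖1 - conj z * t‖ with hDdef
  have h1 : ‖(t : ℂ) - z‖ ^ 2 ≤ k ^ 2 * D ^ 2 := by
    rw [norm_sub_rev, ← mul_pow]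
    refine pow_le_pow_left₀ (norm_nonneg _) ?_ 2
    rw [← div_le_iff₀ hD, ← norm_div]
    exact hqk
  have h2 := sq_norm_one_sub_conj_mul z t
  rw [Complex.norm_real, Real.norm_eq_abs, sq_abs] at h2
  have ht3 : 0 < 1 - t ^ 2 := by nlinarith
  have hz1 : 0 < 1 - ‖z‖ ^ 2 := sub_pos.2 (sq_norm_lt_one hz)
  have h3 : |z.im| ≤ D := by
    have h4 : |z.im| ≤ ‖(t : ℂ) - z‖ := by
      have := Complex.abs_im_le_norm ((t : ℂ) - z)
      simpa using this
    have h5 : ‖(t : ℂ) - z‖ ≤ D := by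
      refine le_of_sq_le_sq ?_ hD.le
      rw [h2]
      linarith [mul_pos hz1 ht3]
    exact h4.trans h5
  have h4 : (1 - t ^ 2) / 2 ≤ D := by
    have h5 : 1 - |t| ≤ D := by
      have h6 := norm_sub_norm_le (1 : ℂ) (conj z * t)
      rw [norm_one, norm_mul, RCLike.norm_conj, Complex.norm_real, Real.norm_eq_abs] at h6
      have h7 : ‖z‖ * |t| ≤ 1 * |t| := by
        gcongr
        exact (mem_ball_zero_iff.1 hz).le
      linarith
    have h6 : |t| < 1 := abs_lt.2 ⟨ht1, ht2⟩
    have h7 : t ^ 2 = |t| ^ 2 := (sq_abs t).symm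
    nlinarith [sq_nonneg (1 - |t|)]
  have h5 : (1 - k ^ 2) * |z.im| ≤ 2 * (1 - ‖z‖ ^ 2) := by
    have h6 : |z.im| * ((1 - t ^ 2) / 2) ≤ D ^ 2 := by
      calc |z.im| * ((1 - t ^ 2) / 2) ≤ D * D := mul_le_mul h3 h4 (by linarith) hD.le
        _ = D ^ 2 := (sq D).symm
    have h7 : (1 - k ^ 2) * D ^ 2 ≤ (1 - ‖z‖ ^ 2) * (1 - t ^ 2) := by linarith
    refine le_of_mul_le_mul_right ?_ ht3
    have h8 : (1 - k ^ 2) * (|z.im| * ((1 - t ^ 2) / 2)) ≤ (1 - k ^ 2) * D ^ 2 := by gcongr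
    linarith
  have h6 : 0 < ‖1 - z‖ ^ 2 := pow_pos (norm_pos_iff.2 (one_sub_ne_zero hz)) 2
  have h7 : (cayley z).im = 2 * z.im / ‖1 - z‖ ^ 2 := by
    rw [cayley, Complex.div_im, ← Complex.normSq_eq_norm_sq]
    simp only [Complex.add_re, Complex.sub_re, Complex.add_im, Complex.sub_im, Complex.one_re,
      Complex.one_im]
    ring
  rw [h7, cayley_re, abs_div, abs_of_pos h6, ← mul_div_assoc, abs_mul, abs_two]
  refine div_lt_div_of_pos_right ?_ h6
  have h8 : 2 * |z.im| ≤ 4 / (1 - k ^ 2) * (1 - ‖z‖ ^ 2) := by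
    rw [div_mul_eq_mul_div, le_div_iff₀ hk2]
    linarith
  linarith

theorem HasAngularLimit.tendsto_radius {g : ℂ → ℂ} {σ : ℂ} (hg : HasAngularLimit g 1 σ) :
    Tendsto (fun x : ℝ => g x) (𝓝[<] 1) (𝓝 σ) := by
  refine (hg 1 one_pos).comp (tendsto_nhdsWithin_iff.2 ⟨?_, ?_⟩)
  · have := (Complex.continuous_ofReal.tendsto 1).mono_left (nhdsWithin_le_nhds (s := Set.Iio 1))
    simpa using this
  · filter_upwards [Ioo_mem_nhdsLT (show (0 : ℝ) < 1 by norm_num)] with x hx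
    refine ⟨?_, x, ⟨x, by linarith [hx.1], hx.2, (mul_one _).symm⟩, ?_⟩
    · rw [mem_ball_zero_iff, Complex.norm_real, Real.norm_of_nonneg hx.1.le]
      exact hx.2
    · simp [hypDist]

theorem IsHolSelfMap.exists_eventually_mul_le_re {f : ℂ → ℂ} (hf : IsHolSelfMap f)
    (hα : boundaryDilation f 1 < ⊤) (h1 : HasAngularLimit f 1 1) :
    ∃ c > 0, ∀ᶠ x : ℝ in atTop, c * x ≤ (halfPlaneMap f x).re := by
  obtain ⟨C, hC, hJ⟩ := hf.exists_julia hα h1.tendsto_radius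
  refine ⟨C⁻¹, by positivity, ?_⟩
  filter_upwards [eventually_gt_atTop 1] with X hX
  have hX1 : 0 < X + 1 := by linarith
  set x := (X - 1) / (X + 1) with hx
  have hxX : cayleyInv X = x := by rw [cayleyInv, hx]; push_cast; rfl
  have hx0 : 0 < x := div_pos (by linarith) hX1
  have hx1 : x < 1 := by rw [hx, div_lt_one hX1]; linarith
  have hxd : (x : ℂ) ∈ disk := by
    rw [mem_ball_zero_iff, Complex.norm_real, Real.norm_of_nonneg hx0.le]
    exact hx1
  have h2 := hJ x hx0 hx1
  -- In the coordinate `X = (1 + x) / (1 - x)`, Julia's inequality on the radius becomes linear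
  -- growth of the real part.
  have h3 : 1 - x ^ 2 = X * (1 - x) ^ 2 := by
    rw [hx]; field_simp; ring
  have h4 : 0 < (1 - x) ^ 2 := pow_pos (by linarith) 2
  have h5 : X * ‖1 - f x‖ ^ 2 ≤ C * (1 - ‖f x‖ ^ 2) := by
    rw [h3] at h2
    refine le_of_mul_le_mul_right ?_ h4
    linarith
  rw [halfPlaneMap, cayley_re, hxX, le_div_iff₀
    (pow_pos (norm_pos_iff.2 (one_sub_ne_zero (hf.2 hxd))) 2), mul_assoc, inv_mul_le_iff₀ hC]
  exact h5

/-- As `z n → 1`, the identity `(1 - u)(cayley u + 1) = 2` makes `|cayley (z n)|` large, and the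
slope bound turns this into a large real part. -/
theorem eventually_cayley_mem_sector {z : ℕ → ℂ} (hz : ∀ n, z n ∈ disk)
    (hz1 : Tendsto z atTop (𝓝 1)) {κ : ℝ} (hκ : 0 < κ)
    (hzκ : ∀ᶠ n in atTop, |(cayley (z n)).im| < κ * (cayley (z n)).re) {R : ℝ} (hR : 0 ≤ R) :
    ∀ᶠ n in atTop, cayley (z n) ∈ sector κ R := by
  have h0 : Tendsto (fun n => ‖1 - z n‖) atTop (𝓝 0) := by
    simpa using (hz1.const_sub 1).norm
  filter_upwards [hzκ, h0.eventually (gt_mem_nhds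
    (show (0 : ℝ) < 2 / ((1 + κ) * R + 1) by positivity))] with n h1 h2
  have h3 := cayley_re_pos (hz n)
  refine ⟨?_, h1⟩
  rw [lt_div_iff₀ (by positivity)] at h2
  have h4 := congrArg norm (one_sub_mul_cayley_add_one (hz n))
  rw [norm_mul, Complex.norm_two] at h4
  have h5 : (1 + κ) * R + 1 < ‖cayley (z n) + 1‖ := by
    refine lt_of_mul_lt_mul_left (h2.trans_eq h4.symm) (norm_nonneg _)
  have h6 : ‖cayley (z n) + 1‖ ≤ ‖cayley (z n)‖ + 1 := by
    simpa using norm_add_le (cayley (z n)) 1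
  have h7 := norm_le_of_mem_sector (κ := κ) le_rfl (w := cayley (z n)) ⟨h3, h1⟩
  refine lt_of_mul_lt_mul_left ?_ (show 0 ≤ 1 + κ by positivity)
  linarith

theorem tendsto_div_of_eventually_norm_sub_le {ι : Type*} {l : Filter ι} {u v : ι → ℂ} {c : ℂ}
    (hv : ∀ᶠ i in l, v i ≠ 0) (h : ∀ ε > 0, ∀ᶠ i in l, ‖u i - c * v i‖ ≤ ε * ‖v i‖) :
    Tendsto (fun i => u i / v i) l (𝓝 c) := by
  rw [Metric.tendsto_nhds]
  intro ε hε
  filter_upwards [hv, h (ε / 2) (half_pos hε)] with i hi h2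
  have h3 : u i / v i - c = (u i - c * v i) / v i := by field_simp
  rw [dist_eq_norm, h3, norm_div, div_lt_iff₀ (norm_pos_iff.2 hi)]
  refine h2.trans_lt ?_
  have := norm_pos_iff.2 hi
  gcongr
  linarith

/-- The quotient equals `(cayley (f z) / cayley z) (1 + z)/2 + (1 - z)/2` exactly, so no prior
knowledge of the limit of `f (z n)` is needed. -/
theorem tendsto_one_sub_div_one_sub {f : ℂ → ℂ} (hf : IsHolSelfMap f) {z : ℕ → ℂ}
    (hz : ∀ n, z n ∈ disk) (hz1 : Tendsto z atTop (𝓝 1)) {c : ℂ}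
    (hc : Tendsto (fun n => cayley (f (z n)) / cayley (z n)) atTop (𝓝 c)) :
    Tendsto (fun n => (1 - z n) / (1 - f (z n))) atTop (𝓝 c) := by
  have h0 : Tendsto (fun n => 1 - z n) atTop (𝓝 0) := by
    simpa using hz1.const_sub 1
  have h1 : Tendsto (fun n => cayley (f (z n)) / cayley (z n) * ((1 + z n) / 2) + (1 - z n) / 2)
      atTop (𝓝 (c * ((1 + 1) / 2) + 0 / 2)) :=
    (hc.mul ((hz1.const_add 1).div_const 2)).add (h0.div_const 2)
  have h2 : c * ((1 + 1) / 2) + 0 / 2 = c := by ring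
  rw [h2] at h1
  refine h1.congr fun n => ?_
  have h3 := one_sub_ne_zero (hz n)
  have h4 := one_sub_ne_zero (hf.2 (hz n))
  have h5 : 1 + z n ≠ 0 := by
    have h6 : (-z n) ∈ disk := by simpa using hz n
    simpa using one_sub_ne_zero h6
  rw [cayley, cayley]
  field_simp
  ring

end BlaschkeJulia

/-! ### The main theorem -/

open BlaschkeJulia

theorem lemma4p1 (f B : ℂ → ℂ)
    (hf : BlaschkeJulia.IsHolSelfMap f)
    (hB : BlaschkeJulia.IsMaximalBlaschkeProduct B f)
    (hα : 0 < BlaschkeJulia.boundaryDilation B 1 ∧ BlaschkeJulia.boundaryDilation B 1 < ⊤)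
    (hB1 : BlaschkeJulia.HasAngularLimit B 1 1)
    (z : ℕ → ℂ) (hz : ∀ n, z n ∈ BlaschkeJulia.disk)
    (hz1 : BlaschkeJulia.TendstoNonTangentially z 1)
    (hfB : (fun n => f (z n) - B (z n)) =O[atTop] (fun n => 1 - z n)) :
    ∃ A : ℝ, 0 < A ∧
      Tendsto (fun n => (1 - ‖f (z n)‖) / (1 - ‖B (z n)‖)) atTop (𝓝 A) ∧
      (∃ V : Set ℂ, V ⊆ BlaschkeJulia.disk ∧ IsOpen V ∧ IsSimplyConnected V ∧
        (1 : ℂ) ∈ frontier V ∧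
        ∀ v ∈ V, ‖1 - f v‖ ^ 2 / (1 - ‖f v‖ ^ 2) ≤ A * (‖1 - B v‖ ^ 2 / (1 - ‖B v‖ ^ 2))) ∧
      ((fun n => f (z n) - B (z n)) =o[atTop] (fun n => 1 - z n) → A = 1) := by
  obtain ⟨hBp, hBf, hmax⟩ := hB
  have hBs : IsHolSelfMap B := hBp.isHolSelfMap
  obtain ⟨hzlim, m, -, hzm⟩ := hz1
  obtain ⟨κ, hκ, hstolz⟩ := exists_abs_im_cayley_lt m
  obtain ⟨c₀, hc₀, hFc₀⟩ := hBs.exists_eventually_mul_le_re hα.2 hB1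
  obtain ⟨c, b, hc, hb0, hasymp, V, hVpos, hVo, hVs, ⟨R, hR, hVR⟩, hVle⟩ :=
    exists_simplyConnected_julia (F := halfPlaneMap B) (K := halfPlaneMap f)
      (fun Z hZ => (hBs.hasDerivAt_halfPlaneMap hZ).differentiableAt.differentiableWithinAt)
      (fun Z hZ => (hf.hasDerivAt_halfPlaneMap hZ).differentiableAt.differentiableWithinAt)
      (fun Z hZ => hBs.halfPlaneMap_re_pos hZ) (fun Z hZ => hf.halfPlaneMap_re_pos hZ)
      (fun Z hZ => hBs.norm_deriv_halfPlaneMap_le hZ)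
      (fun Z hZ => by
        rw [hf.norm_deriv_halfPlaneMap_div hZ, hBs.norm_deriv_halfPlaneMap_div hZ]
        -- Maximality is applied to the competitor `g = f`.
        exact mul_le_mul_of_nonneg_right (hmax f hf hBf _ (cayleyInv_mem_disk hZ)) (by positivity))
      hc₀ hFc₀ hκ
  have hmem : ∀ {S : ℝ}, 0 ≤ S → ∀ᶠ n in atTop, cayley (z n) ∈ sector κ S := fun hS =>
    eventually_cayley_mem_sector hz hzlim hκ (hzm.mono fun n hn => hstolz _ hn) hS
  have hFz : ∀ u ∈ disk, halfPlaneMap B (cayley u) = cayley (B u) := fun u hu => by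
    rw [halfPlaneMap, cayleyInv_cayley hu]
  have hKz : ∀ u ∈ disk, halfPlaneMap f (cayley u) = cayley (f u) := fun u hu => by
    rw [halfPlaneMap, cayleyInv_cayley hu]
  have hne : ∀ u ∈ disk, cayley u ≠ 0 := fun u hu h => by
    have := cayley_re_pos hu
    rw [h] at this
    simp at this
  have hev : ∀ ε > 0, ∀ᶠ n in atTop, ‖cayley (B (z n)) - c * cayley (z n)‖ ≤ ε * ‖cayley (z n)‖ ∧
      ‖cayley (f (z n)) - b * cayley (B (z n))‖ ≤ ε * ‖cayley (B (z n))‖ ∧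
      cayley (B (z n)) ∈ sector (κ + 1) 0 := by
    intro ε hε
    obtain ⟨S, hS, h⟩ := hasymp ε hε
    filter_upwards [hmem hS] with n hn
    have := h _ hn
    rwa [hFz _ (hz n), hKz _ (hz n)] at this
  have hlimF : Tendsto (fun n => cayley (B (z n)) / cayley (z n)) atTop (𝓝 (c : ℂ)) :=
    tendsto_div_of_eventually_norm_sub_le (Eventually.of_forall fun n => hne _ (hz n))
      fun ε hε => (hev ε hε).mono fun n h => h.1
  have hlimKF : Tendsto (fun n => cayley (f (z n)) / cayley (B (z n))) atTop (𝓝 (b : ℂ)) :=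
    tendsto_div_of_eventually_norm_sub_le (Eventually.of_forall fun n => hne _ (hBs.2 (hz n)))
      fun ε hε => (hev ε hε).mono fun n h => h.2.1
  have hlimK : Tendsto (fun n => cayley (f (z n)) / cayley (z n)) atTop (𝓝 ((b : ℂ) * c)) :=
    (hlimKF.mul hlimF).congr fun n => div_mul_div_cancel₀ (hne _ (hBs.2 (hz n)))
  have hBq := tendsto_one_sub_div_one_sub hBs hz hzlim hlimF
  have hfq := tendsto_one_sub_div_one_sub hf hz hzlim hlimK
  have hc' : (c : ℂ) ≠ 0 := by exact_mod_cast hc.ne'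
  have hz0 : ∀ n, 1 - z n ≠ 0 := fun n => one_sub_ne_zero (hz n)
  have hB0 : ∀ n, 1 - B (z n) ≠ 0 := fun n => one_sub_ne_zero (hBs.2 (hz n))
  have hf0 : ∀ n, 1 - f (z n) ≠ 0 := fun n => one_sub_ne_zero (hf.2 (hz n))
  have hBq' : Tendsto (fun n => (1 - B (z n)) / (1 - z n)) atTop (𝓝 (c : ℂ)⁻¹) :=
    (hBq.inv₀ hc').congr fun n => inv_div _ _
  -- If `b = 0`, then `|1 - z| / |1 - f| → 0`; but `|1 - f| ≤ |1 - B| + C |1 - z|` is of order `|1 -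
  -- z|`, a contradiction.
  have hb : 0 < b := by
    obtain ⟨C, hC⟩ := hfB.bound
    refine hb0.lt_of_ne' fun hb => ?_
    rw [hb, Complex.ofReal_zero, zero_mul] at hfq
    have h1 : Tendsto (fun n => ‖(1 - z n) / (1 - f (z n))‖ * (‖(1 - B (z n)) / (1 - z n)‖ + C)) atTop
        (𝓝 (‖(0 : ℂ)‖ * (‖(c : ℂ)⁻¹‖ + C))) := hfq.norm.mul (hBq'.norm.add_const C)
    rw [norm_zero, zero_mul] at h1
    have h2 : (1 : ℝ) ≤ 0 := by
      refine ge_of_tendsto h1 ?_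
      filter_upwards [hC] with n hn
      have h3 := norm_pos_iff.2 (hz0 n)
      have h4 := norm_pos_iff.2 (hf0 n)
      have h5 : ‖1 - f (z n)‖ ≤ ‖1 - B (z n)‖ + ‖f (z n) - B (z n)‖ := by
        have := norm_sub_le (1 - B (z n)) (f (z n) - B (z n))
        rwa [sub_sub_sub_cancel_right] at this
      rw [norm_div, norm_div]
      have h6 : ‖1 - z n‖ / ‖1 - f (z n)‖ * (‖1 - B (z n)‖ / ‖1 - z n‖ + C) =
          (‖1 - B (z n)‖ + C * ‖1 - z n‖) / ‖1 - f (z n)‖ := by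
        field_simp
      rw [h6, one_le_div h4]
      linarith
    linarith
  have hb' : (b : ℂ) ≠ 0 := by exact_mod_cast hb.ne'
  have hfq' : Tendsto (fun n => (1 - f (z n)) / (1 - z n)) atTop (𝓝 ((b : ℂ) * c)⁻¹) :=
    (hfq.inv₀ (mul_ne_zero hb' hc')).congr fun n => inv_div _ _
  have hz0' : Tendsto (fun n => 1 - z n) atTop (𝓝 0) := by
    simpa using hzlim.const_sub 1
  have hlim1 : ∀ {g : ℂ → ℂ} {d : ℂ}, Tendsto (fun n => (1 - g (z n)) / (1 - z n)) atTop (𝓝 d) →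
      Tendsto (fun n => ‖g (z n)‖) atTop (𝓝 1) := by
    intro g d h
    have h1 := ((h.mul hz0').const_sub 1).norm
    rw [mul_zero, sub_zero, norm_one] at h1
    refine h1.congr fun n => ?_
    rw [div_mul_cancel₀ _ (hz0 n), sub_sub_cancel]
  -- Passing from complex quotients to quotients of real parts is legitimate because `cayley (B (z
  -- n))` stays in a sector, where norm and real part are comparable.
  have hre : Tendsto (fun n => (cayley (f (z n))).re / (cayley (B (z n))).re) atTop (𝓝 b) := by
    rw [Metric.tendsto_nhds]
    intro ε hε
    filter_upwards [hev (ε / (2 * (2 + κ))) (by positivity)] with n hn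
    obtain ⟨-, h1, h2⟩ := hn
    have h3 := cayley_re_pos (hBs.2 (hz n))
    have h4 := norm_le_of_mem_sector le_rfl h2
    have h5 := (Complex.abs_re_le_norm _).trans h1
    rw [Complex.sub_re, Complex.re_ofReal_mul] at h5
    have h6 : (cayley (f (z n))).re / (cayley (B (z n))).re - b =
        ((cayley (f (z n))).re - b * (cayley (B (z n))).re) / (cayley (B (z n))).re := by
      field_simp
    rw [Real.dist_eq, h6, abs_div, abs_of_pos h3, div_lt_iff₀ h3]
    calc _ ≤ ε / (2 * (2 + κ)) * ‖cayley (B (z n))‖ := h5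
      _ ≤ ε / (2 * (2 + κ)) * ((1 + (κ + 1)) * (cayley (B (z n))).re) := by gcongr
      _ = ε / 2 * (cayley (B (z n))).re := by field_simp; ring
      _ < _ := by gcongr; linarith
  refine ⟨b⁻¹, by positivity, ?_, ⟨disk ∩ cayley ⁻¹' V, Set.inter_subset_left,
    continuousOn_cayley.isOpen_inter_preimage Metric.isOpen_ball hVo, ?_, ?_, ?_⟩, fun ho => ?_⟩
  · have h1 : Tendsto (fun n => (cayley (f (z n))).re / (cayley (B (z n))).re *
        (‖(1 - z n) / (1 - B (z n))‖ * ‖(1 - f (z n)) / (1 - z n)‖) ^ 2 *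
        ((1 + ‖B (z n)‖) / (1 + ‖f (z n)‖))) atTop
        (𝓝 (b * (‖(c : ℂ)‖ * ‖((b : ℂ) * c)⁻¹‖) ^ 2 * ((1 + 1) / (1 + 1)))) :=
      (hre.mul ((hBq.norm.mul hfq'.norm).pow 2)).mul
        (((hlim1 hBq').const_add 1).div ((hlim1 hfq').const_add 1) (by norm_num))
    have h2 : b * (‖(c : ℂ)‖ * ‖((b : ℂ) * c)⁻¹‖) ^ 2 * ((1 + 1) / (1 + 1)) = b⁻¹ := by
      rw [norm_inv, norm_mul, Complex.norm_real, Complex.norm_real, Real.norm_of_nonneg hc.le,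
        Real.norm_of_nonneg hb.le]
      field_simp
    rw [h2] at h1
    refine h1.congr fun n => ?_
    have h3 := norm_pos_iff.2 (hz0 n)
    have h4 := norm_pos_iff.2 (hf0 n)
    have h5 := norm_pos_iff.2 (hB0 n)
    have h6 : 0 < 1 - ‖B (z n)‖ := sub_pos.2 (mem_ball_zero_iff.1 (hBs.2 (hz n)))
    have h7 : 0 < 1 + ‖B (z n)‖ := by positivity
    have h8 : 0 < 1 + ‖f (z n)‖ := by positivity
    have h9 : ∀ r : ℝ, 1 - r ^ 2 = (1 - r) * (1 + r) := fun r => by ring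
    rw [cayley_re, cayley_re, norm_div, norm_div, h9, h9]
    field_simp
  · have himage : disk ∩ cayley ⁻¹' V = cayleyInv '' V := by
      ext u
      constructor
      · rintro ⟨hu, huV⟩
        exact ⟨_, huV, cayleyInv_cayley hu⟩
      · rintro ⟨Z, hZ, rfl⟩
        refine ⟨cayleyInv_mem_disk (hVpos hZ), ?_⟩
        rwa [Set.mem_preimage, cayley_cayleyInv (hVpos hZ)]
    rw [himage]
    refine isSimplyConnected_image_of_leftInvOn hVs (continuousOn_cayleyInv.mono hVpos)
      (continuousOn_cayley.mono ?_) fun Z hZ => cayley_cayleyInv (hVpos hZ)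
    rw [← himage]
    exact Set.inter_subset_left
  · refine ⟨mem_closure_of_tendsto hzlim ?_, fun h => ?_⟩
    · filter_upwards [hmem hR] with n hn
      exact ⟨hz n, hVR hn⟩
    · have := (interior_subset h).1
      simp at this
  · rintro v ⟨hv, hvV⟩
    have h1 := hVle _ hvV
    rw [hFz v hv, hKz v hv] at h1
    have h2 := cayley_re_pos (hBs.2 hv)
    have h3 := cayley_re_pos (hf.2 hv)
    -- The two sides of the claim are reciprocals of real parts of Cayley transforms, so inverting
    -- `b Re F ≤ Re K` gives it with constant `b⁻¹`.
    have h4 := inv_anti₀ (by positivity) h1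
    rwa [mul_inv, cayley_re, cayley_re, inv_div, inv_div] at h4
  · have h1 := ho.tendsto_div_nhds_zero
    -- The same quotient tends to 0 by the `o` hypothesis, which forces `1/c = 1/(bc)`.
    have h2 : Tendsto (fun n => (f (z n) - B (z n)) / (1 - z n)) atTop
        (𝓝 ((c : ℂ)⁻¹ - ((b : ℂ) * c)⁻¹)) :=
      (hBq'.sub hfq').congr fun n => by rw [← sub_div, sub_sub_sub_cancel_left]
    have h3 := tendsto_nhds_unique h1 h2
    have h4 : (b : ℂ)⁻¹ = 1 := by
      rw [mul_inv, eq_comm, sub_eq_zero] at h3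
      exact mul_right_cancel₀ (inv_ne_zero hc') (by rw [← h3, one_mul])
    exact_mod_cast h4
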